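/- Let $p \ge 1$, let $n \ge 6$ be divisible by $3$, and let $\Sigma \in \mathbb{R}^{p\times p}$ be positive definite. We observe $X = (X_1,\dots,X_n) \in \mathbb{R}^{p \times n}$ with independent columns $X_t \sim N_p(\theta_t, \Sigma)$, where $\theta = (\theta_1,\dots,\theta_n) \in \mathbb{R}^{p\times n}$ is deterministic; $\mathbb{E}_\theta$ denotes expectation under this law. Write $\|\cdot\|$ for the Euclidean norm, $\|\cdot\|_F$ and $\|\cdot\|_{\mathrm{op}}$ for the Frobenius and operator (largest singular value) norms, and $a \vee b = \max(a,b)$. Let $\Theta_0(p,n)$ be the set of $\theta$ all of whose columns are equal. For $\rho > 0$ let $\Theta(p,n,p,\rho)$ be the set of $\theta$ for which there are $t_0 \in \{1,\dots,n-1\}$ and $\mu_1,\mu_2 \in \mathbb{R}^p$ with $\theta_t = \mu_1$ for $t \le t_0$, $\theta_t = \mu_2$ for $t > t_0$, $\mu_1 - \mu_2$ having at most $p$ non-zero coordinates, and $\frac{t_0(n-t_0)}{n}\|\mu_1-\mu_2\|^2 \ge \rho^2$. Let $\mathcal{T} = \{1,2,4,\dots,2^{\lfloor \log_2(n/2)\rfloor}\}$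 and, for $t \in \mathcal{T}$, $$Y_t = \frac{(X_1+\dots+X_t) - (X_{n-t+1}+\dots+X_n)}{\sqrt{2t}}.$$ Divide $\{1,\dots,n\}$ into three consecutive blocks $\mathcal{D}_1,\mathcal{D}_2,\mathcal{D}_3$ of size $n/3$, and for each $j$ let $$\widehat\Sigma_{\mathcal{D}_j} = \frac{1}{|\mathcal{D}_j|-1}\sum_{t\in\mathcal{D}_j}(X_t-\bar X_{\mathcal{D}_j})(X_t-\bar X_{\mathcal{D}_j})^T, \qquad \bar X_{\mathcal{D}_j} = \frac{1}{|\mathcal{D}_j|}\sum_{t\in\mathcal{D}_j}X_t .$$ Let $\mathrm{Tr}(\widehat\Sigma)^{(2)}$, $\|\widehat\Sigma\|_F^{(2)}$ and $\|\widehat\Sigma\|_{\mathrm{op}}^{(2)}$ be the medians over $j \in \{1,2,3\}$ of the traces, the Frobenius norms and the operator norms of $\widehat\Sigma_{\mathcal{D}_j}$, respectively. For $C > 0$ define the test $$\psi_{\mathrm{Cov}} = \mathbf{1}\Bigl\{\max_{t\in\mathcal{T}}\|Y_t\|^2 - \mathrm{Tr}(\widehat\Sigma)^{(2)} > C\bigl(\|\widehat\Sigma\|_F^{(2)}\sqrt{\log\log(8n)}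 \vee \|\widehat\Sigma\|_{\mathrm{op}}^{(2)}\log\log(8n)\bigr)\Bigr\}.$$ Statement. For all $A > 0$ and $\epsilon > 0$ there exist $c, C > 0$, depending only on $A$ and $\epsilon$, such that for all $p$, $n$, $\Sigma$ as above with $\sqrt{p}\,\|\Sigma\|_{\mathrm{op}} \le A\|\Sigma\|_F$ and $p \le cn$, and every $\rho > 0$ with $\rho^2 \ge 64C\bigl(\|\Sigma\|_F\sqrt{\log\log(8n)} \vee \|\Sigma\|_{\mathrm{op}}\log\log(8n)\bigr)$, the function $\psi_{\mathrm{Cov}}$ is a measurable function of $X$ and $$\sup_{\theta\in\Theta_0(p,n)}\mathbb{E}_\theta\,\psi_{\mathrm{Cov}} + \sup_{\theta\in\Theta(p,n,p,\rho)}\mathbb{E}_\theta(1-\psi_{\mathrm{Cov}}) \le \epsilon .$$ -/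

import Mathlib

open MeasureTheory ProbabilityTheory

noncomputable section

namespace Changepoint

/-- A `p × n` real matrix, stored as the sequence of its `n` columns in Euclidean `ℝ^p`.
The column `t` in one-based numbering has index `t - 1` in `Fin n`. -/
abbrev Columns (p n : ℕ) : Type := Fin n → EuclideanSpace ℝ (Fin p)

/-- The number of non-zero coordinates of a vector. -/
def l0norm {p : ℕ} (v : EuclideanSpace ℝ (Fin p)) : ℕ :=
  {j | v j ≠ 0}.ncard

/-- The signals without a changepoint. -/
def nullSpace (p n : ℕ) : Set (Columns p n) :=
  {θ | ∃ μ, ∀ t, θ t = μ}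

/-- The signals with an `s`-sparse change of strength at least `ρ` after the first `t₀` columns. -/
def altSpaceAt (t₀ p n s : ℕ) (ρ : ℝ) : Set (Columns p n) :=
  {θ | ∃ μ₁ μ₂ : EuclideanSpace ℝ (Fin p),
    (∀ i : Fin n, (i : ℕ) < t₀ → θ i = μ₁) ∧
    (∀ i : Fin n, t₀ ≤ (i : ℕ) → θ i = μ₂) ∧
    l0norm (μ₁ - μ₂) ≤ s ∧
    ρ ^ 2 ≤ (t₀ : ℝ) * ((n : ℝ) - t₀) / n * ‖μ₁ - μ₂‖ ^ 2}

/-- The signals with such a change at some time `1 ≤ t₀ ≤ n - 1`. -/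
def altSpace (p n s : ℕ) (ρ : ℝ) : Set (Columns p n) :=
  {θ | ∃ t₀ : ℕ, 1 ≤ t₀ ∧ t₀ < n ∧ θ ∈ altSpaceAt t₀ p n s ρ}

/-- The law of the data: independent columns, column `t` distributed as `N_p(θ_t, S)`. -/
def dataLaw {p n : ℕ} (S : Matrix (Fin p) (Fin p) ℝ) (θ : Columns p n) :
    Measure (Columns p n) :=
  Measure.pi fun t => multivariateGaussian (θ t) S

/-- The Frobenius norm. -/
def frobNorm {p : ℕ} (M : Matrix (Fin p) (Fin p) ℝ) : ℝ :=
  Real.sqrt (∑ i, ∑ j, M i j ^ 2)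

/-- The operator norm of a matrix acting on Euclidean space, i.e. its largest singular value. -/
def opNorm {p : ℕ} (M : Matrix (Fin p) (Fin p) ℝ) : ℝ :=
  ‖Matrix.toEuclideanCLM (𝕜 := ℝ) M‖

/-- The statistic
`Y_t = ((X_1 + ⋯ + X_t) - (X_{n-t+1} + ⋯ + X_n)) / √(2t)`, used for `1 ≤ t ≤ n / 2`. -/
def cusum {p n : ℕ} (t : ℕ) (X : Columns p n) : EuclideanSpace ℝ (Fin p) :=
  (Real.sqrt (2 * t))⁻¹ •
    ((∑ i ∈ Finset.univ.filter (fun i : Fin n => (i : ℕ) < t), X i) -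
      ∑ i ∈ Finset.univ.filter (fun i : Fin n => n - t ≤ (i : ℕ)), X i)

/-- The grid `{1, 2, 4, …, 2 ^ ⌊log₂ (n / 2)⌋}`. -/
def candidateTimes (n : ℕ) : Finset ℕ :=
  (Finset.range (⌊Real.logb 2 ((n : ℝ) / 2)⌋₊ + 1)).image fun k => 2 ^ k

theorem candidateTimes_nonempty (n : ℕ) : (candidateTimes n).Nonempty :=
  Finset.Nonempty.image Finset.nonempty_range_add_one _

/-- `max_{t ∈ T} ‖Y_t‖²` over the grid `T` of candidate times. -/
def maxCusumSq {p n : ℕ} (X : Columns p n) : ℝ :=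
  (candidateTimes n).sup' (candidateTimes_nonempty n) fun t => ‖cusum t X‖ ^ 2

/-- The mean of the columns with index in `D`. -/
def blockMean {p n : ℕ} (D : Finset (Fin n)) (X : Columns p n) : EuclideanSpace ℝ (Fin p) :=
  (D.card : ℝ)⁻¹ • ∑ t ∈ D, X t

/-- The unbiased sample covariance matrix of the columns with index in `D`. -/
def sampleCov {p n : ℕ} (D : Finset (Fin n)) (X : Columns p n) : Matrix (Fin p) (Fin p) ℝ :=
  ((D.card : ℝ) - 1)⁻¹ •
    ∑ t ∈ D, Matrix.vecMulVec (X t - blockMean D X).ofLp (X t - blockMean D X).ofLp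

/-- The three consecutive blocks of length `n / 3` (for `n` divisible by `3`). -/
def block (n : ℕ) (j : Fin 3) : Finset (Fin n) :=
  {i | (j : ℕ) * (n / 3) ≤ (i : ℕ) ∧ (i : ℕ) < ((j : ℕ) + 1) * (n / 3)}

/-- The middle one of three real numbers. -/
def median3 (a : Fin 3 → ℝ) : ℝ :=
  max (min (a 0) (a 1)) (min (max (a 0) (a 1)) (a 2))

/-- Median of the traces of the three block sample covariances. -/
def medTrace {p n : ℕ} (X : Columns p n) : ℝ :=
  median3 fun j => (sampleCov (block n j) X).trace

/-- Median of the Frobenius norms of the three block sample covariances. -/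
def medFrob {p n : ℕ} (X : Columns p n) : ℝ :=
  median3 fun j => frobNorm (sampleCov (block n j) X)

/-- Median of the operator norms of the three block sample covariances. -/
def medOp {p n : ℕ} (X : Columns p n) : ℝ :=
  median3 fun j => opNorm (sampleCov (block n j) X)

/-- `log log (8 n)`. -/
def loglog8 (n : ℕ) : ℝ := Real.log (Real.log (8 * n))

/-- The test with plugged-in covariance functionals: it equals `1` on the rejection region and `0`
elsewhere. -/
def psiCov {p n : ℕ} (C : ℝ) : Columns p n → ℝ :=
  Set.indicator
    {X | C * max (medFrob X * Real.sqrt (loglog8 n)) (medOp X * loglog8 n)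
      < maxCusumSq X - medTrace X}
    (fun _ => 1)

end Changepoint

end

open Changepoint

/-! ### One-dimensional Gaussian integrals. -/

namespace Changepoint

open scoped NNReal ENNReal RealInnerProductSpace

/-! Write `X = θ + Z` with centred noise `Z`, `L = log log (8n)`, and let `R` (`rate`) be the
maximum of `‖Σ‖_F √L` and `‖Σ‖_op L`. A sample covariance does not see a constant mean, and a single
change spoils at most one of the three blocks. So two blocks always yield pure noise covariances,
and a median of three lies between any two-sided bounds shared by two of the values.

For pure noise, outside an event of probability at most `900c`, every block has trace within `‖Σ‖_F`
of the truth, Frobenius norm within `‖Σ‖_F / 2`, and operator norm between `1/2` and `10` times the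
truth (`measureReal_not_isGoodEstimate`, `median_bounds`). Trace, Frobenius norm and the lower
operator bound follow from Chebyshev, since functionals of the sample covariance are unbiased
quadratic estimators (`blockEstimator_sq_error`). The upper operator bound averages an exponential
moment over the unit ball (`measureReal_lt_opNorm_sampleCov`). The random threshold is thus between
`CR/2` and `10CR`, with trace error at most `R`.

Without a change each `Y_t` is `N(0, Σ)`. The Chernoff bound `measureReal_norm_sq_ge_le` decays like
a power of `exp (-L)`, which beats the at most `2 exp L` grid points (`null_rejection_le`). With a
change, a grid time within a factor two of the distance from the change to the boundary has mean `η`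
with `‖η‖² ≥ ρ²/4 ≥ 16CR`; Chebyshev at this single time controls the noise and the cross term
(`alt_acceptance_le`). -/

theorem integral_pow_four_gaussianReal (v : ℝ≥0) :
    ∫ x, x ^ 4 ∂(gaussianReal 0 v) = 3 * (v : ℝ) ^ 2 := by
  have h := iteratedDeriv_mgf_zero (X := fun x : ℝ => x) (μ := gaussianReal 0 v) (by simp) 4
  have e : ∀ t : ℝ, HasDerivAt (fun t : ℝ => Real.exp (0 * t + v * t ^ 2 / 2))
      (v * t * Real.exp (0 * t + v * t ^ 2 / 2)) t := by
    intro t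
    have : HasDerivAt (fun t : ℝ => 0 * t + v * t ^ 2 / 2) (v * t) t := by
      have := (((hasDerivAt_id t).pow 2).const_mul (v : ℝ)).div_const 2
      convert! this using 1
      · ext; simp
      · simp; ring
    convert! this.exp using 1
    ring
  -- Every derivative of the moment generating function is a polynomial times the same exponential;
  -- `q ↦ q' + q · v t` is the recursion for the polynomial.
  have step : ∀ (q q' : ℝ → ℝ), (∀ t, HasDerivAt q (q' t) t) →
      deriv (fun t => q t * Real.exp (0 * t + v * t ^ 2 / 2)) =
        fun t => (q' t + q t * (v * t)) * Real.exp (0 * t + v * t ^ 2 / 2) := by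
    intro q q' hq
    ext t
    rw [((hq t).fun_mul (e t)).deriv]
    ring
  have p : ∀ (k : ℕ) (t : ℝ), HasDerivAt (fun t : ℝ => t ^ (k + 1)) ((k + 1) * t ^ k) t := by
    intro k t
    simpa using hasDerivAt_pow (k + 1) t
  rw [mgf_fun_id_gaussianReal, iteratedDeriv_eq_iterate] at h
  simp only [Function.iterate_succ, Function.iterate_zero, Function.comp_apply, id] at h
  have d1 : deriv (fun t : ℝ => Real.exp (0 * t + v * t ^ 2 / 2)) =
      fun t => (v * t) * Real.exp (0 * t + v * t ^ 2 / 2) := by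
    ext t; exact (e t).deriv
  rw [d1, step (fun t => v * t) (fun t => v) (fun t => by
      simpa using (hasDerivAt_id t).const_mul (v : ℝ)),
    step (fun t => v + v * t * (v * t)) (fun t => 2 * v ^ 2 * t) (fun t => by
      have := ((p 1 t).const_mul ((v : ℝ) ^ 2)).const_add (v : ℝ)
      convert! this using 1
      · ext; ring
      · push_cast; ring),
    step (fun t => 2 * v ^ 2 * t + (v + v * t * (v * t)) * (v * t))
      (fun t => 3 * v ^ 2 + 3 * v ^ 3 * t ^ 2) (fun t => by
      have := ((p 0 t).const_mul (3 * (v : ℝ) ^ 2)).add ((p 2 t).const_mul ((v : ℝ) ^ 3))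
      convert! this using 1
      · ext; simp; ring
      · push_cast; ring)] at h
  simp at h
  exact h.symm

/-- The integral equals `(1 - 2s)^(-1/2)`. Keeping the exact linear term `s` matters: summed over
eigenvalues it becomes the trace, and `2s²` becomes the squared Frobenius norm. -/
theorem lintegral_exp_mul_sq_gaussianReal_le {s : ℝ} (hs : 0 ≤ s) (hs' : s ≤ 1 / 4) :
    ∫⁻ x, ENNReal.ofReal (Real.exp (s * x ^ 2)) ∂(gaussianReal 0 1) ≤
      ENNReal.ofReal (Real.exp (s + 2 * s ^ 2)) := by
  have hb : 0 < 1 / 2 - s := by linarith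
  rw [gaussianReal_of_var_ne_zero _ one_ne_zero,
    lintegral_withDensity_eq_lintegral_mul _ (measurable_gaussianPDF _ _) (by fun_prop)]
  have h1 : ∀ x : ℝ, (gaussianPDF 0 1 * fun x => ENNReal.ofReal (Real.exp (s * x ^ 2))) x =
      ENNReal.ofReal ((Real.sqrt (2 * Real.pi))⁻¹ * Real.exp (-(1 / 2 - s) * x ^ 2)) := by
    intro x
    rw [Pi.mul_apply, gaussianPDF, ← ENNReal.ofReal_mul (gaussianPDFReal_nonneg _ _ _),
      gaussianPDFReal_def]
    simp only [NNReal.coe_one, mul_one, sub_zero]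
    rw [mul_assoc, ← Real.exp_add]
    congr 3
    ring
  simp_rw [h1]
  rw [← ofReal_integral_eq_lintegral_ofReal ((integrable_exp_neg_mul_sq hb).const_mul _)
    (ae_of_all _ fun x => by positivity), integral_const_mul, integral_gaussian]
  apply ENNReal.ofReal_le_ofReal
  rw [← Real.sqrt_inv, ← Real.sqrt_mul (by positivity)]
  apply Real.sqrt_le_iff.2 ⟨by positivity, ?_⟩
  have h2 : (2 * Real.pi)⁻¹ * (Real.pi / (1 / 2 - s)) = (1 - 2 * s)⁻¹ := by
    have := Real.pi_pos.ne'
    have h3 : (1 - 2 * s) ≠ 0 := by linarith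
    field_simp
  rw [h2, ← Real.exp_nat_mul, inv_le_iff_one_le_mul₀ (by linarith)]
  -- After squaring, the claim is `1 ≤ exp (2s + 4s²) (1 - 2s)`, and the quadratic Taylor lower
  -- bound of `exp` suffices for `s ≤ 1/4`.
  have h3 : (0 : ℝ) ≤ 2 * s + 4 * s ^ 2 := by positivity
  have h4 := Real.quadratic_le_exp_of_nonneg h3
  have h6 : ((2 : ℕ) : ℝ) * (s + 2 * s ^ 2) = 2 * s + 4 * s ^ 2 := by push_cast; ring
  rw [h6]
  refine le_trans ?_ (mul_le_mul_of_nonneg_right h4 (by linarith : (0 : ℝ) ≤ 1 - 2 * s))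
  have h7 : 0 ≤ s ^ 2 * (2 - 4 * s - 8 * s ^ 2 - 16 * s ^ 3) := by
    apply mul_nonneg (sq_nonneg s)
    have : s ^ 2 ≤ (1 / 4) ^ 2 := pow_le_pow_left₀ hs hs' 2
    have : s ^ 3 ≤ (1 / 4) ^ 3 := pow_le_pow_left₀ hs hs' 3
    linarith
  linarith

theorem lintegral_pi_prod {ι : Type*} [Fintype ι] {Ω : ι → Type*} [∀ i, MeasurableSpace (Ω i)]
    (μ : ∀ i, Measure (Ω i)) [∀ i, IsProbabilityMeasure (μ i)] (f : ∀ i, Ω i → ℝ≥0∞)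
    (hf : ∀ i, Measurable (f i)) :
    ∫⁻ x, ∏ i, f i (x i) ∂(Measure.pi μ) = ∏ i, ∫⁻ x, f i x ∂(μ i) := by
  have h := iIndepFun_pi (μ := μ) (X := f) fun i => (hf i).aemeasurable
  have h2 := lintegral_prod_eq_prod_lintegral_of_indepFun Finset.univ
    (fun i (x : ∀ i, Ω i) => f i (x i)) h (fun i => (hf i).comp (measurable_pi_apply i))
  rw [h2]
  refine Finset.prod_congr rfl fun i _ => ?_
  rw [← (measurePreserving_eval μ i).lintegral_comp (hf i)]

end Changepoint

namespace Changepoint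

open scoped NNReal ENNReal RealInnerProductSpace

/-! ### Quadratic forms, eigenvalues and matrix norms. -/

section Spectral

variable {p : ℕ} {S : Matrix (Fin p) (Fin p) ℝ}

/-- The quadratic form of a matrix on Euclidean space. -/
noncomputable def quadForm (S : Matrix (Fin p) (Fin p) ℝ) (u : EuclideanSpace ℝ (Fin p)) : ℝ :=
  ⟪u, Matrix.toEuclideanCLM (𝕜 := ℝ) S u⟫

theorem quadForm_eq_sum (S : Matrix (Fin p) (Fin p) ℝ) (u : EuclideanSpace ℝ (Fin p)) :
    quadForm S u = ∑ i, ∑ j, u i * S i j * u j := by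
  rw [quadForm, Matrix.inner_toEuclideanCLM, dotProduct]
  refine Finset.sum_congr rfl fun i _ => ?_
  rw [Matrix.mulVec, dotProduct, Finset.mul_sum]
  exact Finset.sum_congr rfl fun j _ => by ring

theorem quadForm_nonneg (hS : S.PosSemidef) (u : EuclideanSpace ℝ (Fin p)) :
    0 ≤ quadForm S u := by
  rw [quadForm, Matrix.inner_toEuclideanCLM]
  simpa using hS.dotProduct_mulVec_nonneg u.ofLp

theorem quadForm_le (S : Matrix (Fin p) (Fin p) ℝ) (u : EuclideanSpace ℝ (Fin p)) :
    quadForm S u ≤ opNorm S * ‖u‖ ^ 2 := by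
  have h1 := real_inner_le_norm u (Matrix.toEuclideanCLM (𝕜 := ℝ) S u)
  have h2 := (Matrix.toEuclideanCLM (𝕜 := ℝ) S).le_opNorm u
  have h3 : 0 ≤ ‖u‖ := norm_nonneg u
  rw [quadForm, opNorm]
  nlinarith

theorem toEuclideanCLM_eigenvectorBasis (hS : S.IsHermitian) (i : Fin p) :
    Matrix.toEuclideanCLM (𝕜 := ℝ) S (hS.eigenvectorBasis i) =
      hS.eigenvalues i • hS.eigenvectorBasis i := by
  have h := hS.mulVec_eigenvectorBasis i
  ext j
  exact congrFun h j

theorem quadForm_eq_sum_eigenvalues (hS : S.IsHermitian) (u : EuclideanSpace ℝ (Fin p)) :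
    quadForm S u = ∑ i, hS.eigenvalues i * ⟪hS.eigenvectorBasis i, u⟫ ^ 2 := by
  conv_lhs => rw [quadForm, ← hS.eigenvectorBasis.sum_repr' u]
  rw [map_sum, inner_sum]
  refine Finset.sum_congr rfl fun i _ => ?_
  rw [map_smul, toEuclideanCLM_eigenvectorBasis, hS.eigenvectorBasis.sum_repr' u,
    inner_smul_right, inner_smul_right, real_inner_comm]
  ring

theorem abs_eigenvalues_le_opNorm (hS : S.IsHermitian) (i : Fin p) :
    |hS.eigenvalues i| ≤ opNorm S := by
  have h := (Matrix.toEuclideanCLM (𝕜 := ℝ) S).le_opNorm (hS.eigenvectorBasis i)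
  rw [toEuclideanCLM_eigenvectorBasis, norm_smul, hS.eigenvectorBasis.norm_eq_one i] at h
  simpa [opNorm] using h

theorem frobNorm_sq (S : Matrix (Fin p) (Fin p) ℝ) : frobNorm S ^ 2 = ∑ i, ∑ j, S i j ^ 2 :=
  Real.sq_sqrt (by positivity)

theorem frobNorm_nonneg (S : Matrix (Fin p) (Fin p) ℝ) : 0 ≤ frobNorm S := Real.sqrt_nonneg _

theorem opNorm_nonneg (S : Matrix (Fin p) (Fin p) ℝ) : 0 ≤ opNorm S := norm_nonneg _

/-- The left side is the sum of `‖S vᵢ‖²` over the eigenbasis; in coordinates, Parseval applied to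
each row of `S` turns it into the right side. -/
theorem sum_eigenvalues_sq (hS : S.IsHermitian) :
    ∑ i, hS.eigenvalues i ^ 2 = frobNorm S ^ 2 := by
  have h1 : ∀ i, hS.eigenvalues i ^ 2 =
      ∑ j, (Matrix.toEuclideanCLM (𝕜 := ℝ) S (hS.eigenvectorBasis i)) j ^ 2 := by
    intro i
    rw [← EuclideanSpace.real_norm_sq_eq, toEuclideanCLM_eigenvectorBasis, norm_smul,
      hS.eigenvectorBasis.norm_eq_one i]
    simp
  have h2 : ∀ i j, (Matrix.toEuclideanCLM (𝕜 := ℝ) S (hS.eigenvectorBasis i)) j =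
      ⟪WithLp.toLp 2 (S j), hS.eigenvectorBasis i⟫ := by
    intro i j
    rw [Matrix.ofLp_toEuclideanCLM, Matrix.mulVec, dotProduct, PiLp.inner_apply]
    exact Finset.sum_congr rfl fun k _ => by simp [mul_comm]
  simp_rw [h1, h2]
  rw [Finset.sum_comm, frobNorm_sq]
  refine Finset.sum_congr rfl fun j _ => ?_
  rw [hS.eigenvectorBasis.sum_sq_inner_left, EuclideanSpace.real_norm_sq_eq]

theorem opNorm_le_frobNorm (S : Matrix (Fin p) (Fin p) ℝ) : opNorm S ≤ frobNorm S := by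
  refine ContinuousLinearMap.opNorm_le_bound _ (frobNorm_nonneg S) fun u => ?_
  refine le_of_sq_le_sq ?_ (by positivity [frobNorm_nonneg S])
  rw [mul_pow, frobNorm_sq, EuclideanSpace.real_norm_sq_eq, EuclideanSpace.real_norm_sq_eq,
    Finset.sum_mul]
  refine Finset.sum_le_sum fun i _ => ?_
  rw [Matrix.ofLp_toEuclideanCLM, Matrix.mulVec, dotProduct]
  exact Finset.sum_mul_sq_le_sq_mul_sq _ _ _

theorem trace_sq_le (S : Matrix (Fin p) (Fin p) ℝ) : S.trace ^ 2 ≤ p * frobNorm S ^ 2 := by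
  have h := sq_sum_le_card_mul_sum_sq (s := (Finset.univ : Finset (Fin p))) (f := fun i => S i i)
  rw [Finset.card_univ, Fintype.card_fin] at h
  refine h.trans (mul_le_mul_of_nonneg_left ?_ (Nat.cast_nonneg p))
  rw [frobNorm_sq]
  exact Finset.sum_le_sum fun i _ =>
    Finset.single_le_sum (f := fun j => S i j ^ 2) (fun j _ => sq_nonneg _) (Finset.mem_univ i)

/-- The operator norm is the largest eigenvalue, and the remaining terms of the spectral expansion
are nonnegative. Applied to `Σ` for the lower bound on the estimated operator norm, and to the
sample covariance for the upper bound. -/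
theorem exists_top_eigenvector (hS : S.PosSemidef) (hp : 1 ≤ p) :
    ∃ v : EuclideanSpace ℝ (Fin p), ‖v‖ = 1 ∧ quadForm S v = opNorm S ∧
      ∀ u, opNorm S * ⟪v, u⟫ ^ 2 ≤ quadForm S u := by
  have hH := hS.isHermitian
  have : Nonempty (Fin p) := ⟨⟨0, hp⟩⟩
  obtain ⟨k, hk⟩ := Finite.exists_max hH.eigenvalues
  have h0 : ∀ i, 0 ≤ hH.eigenvalues i := hS.eigenvalues_nonneg
  have hle : opNorm S ≤ hH.eigenvalues k := by
    refine ContinuousLinearMap.opNorm_le_bound _ (h0 k) fun u => ?_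
    refine le_of_sq_le_sq ?_ (by have := h0 k; positivity)
    rw [mul_pow, ← hH.eigenvectorBasis.sum_sq_inner_right u,
      ← hH.eigenvectorBasis.sum_sq_inner_right (Matrix.toEuclideanCLM (𝕜 := ℝ) S u), Finset.mul_sum]
    refine Finset.sum_le_sum fun i _ => ?_
    have h1 : ⟪hH.eigenvectorBasis i, Matrix.toEuclideanCLM (𝕜 := ℝ) S u⟫ =
        hH.eigenvalues i * ⟪hH.eigenvectorBasis i, u⟫ := by
      conv_lhs => rw [← hH.eigenvectorBasis.sum_repr' u]
      rw [map_sum, inner_sum]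
      simp only [map_smul, toEuclideanCLM_eigenvectorBasis, inner_smul_right,
        orthonormal_iff_ite.1 hH.eigenvectorBasis.orthonormal]
      simp [mul_comm]
    rw [h1, mul_pow]
    exact mul_le_mul_of_nonneg_right (pow_le_pow_left₀ (h0 i) (hk i) 2) (sq_nonneg _)
  have heq : opNorm S = hH.eigenvalues k :=
    le_antisymm hle ((le_abs_self _).trans (abs_eigenvalues_le_opNorm hH k))
  refine ⟨hH.eigenvectorBasis k, hH.eigenvectorBasis.norm_eq_one k, ?_, fun u => ?_⟩
  · rw [quadForm, toEuclideanCLM_eigenvectorBasis, inner_smul_right, real_inner_self_eq_norm_sq,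
      hH.eigenvectorBasis.norm_eq_one k, heq]
    simp
  · rw [heq, quadForm_eq_sum_eigenvalues hH]
    exact Finset.single_le_sum (f := fun i => hH.eigenvalues i * ⟪hH.eigenvectorBasis i, u⟫ ^ 2)
      (fun i _ => mul_nonneg (h0 i) (sq_nonneg _)) (Finset.mem_univ k)

end Spectral

/-! ### Second and fourth moments of a centred Gaussian vector. -/

section GaussianMoments

variable {p : ℕ} {S : Matrix (Fin p) (Fin p) ℝ}

theorem map_inner_multivariateGaussian (hS : S.PosSemidef) (u : EuclideanSpace ℝ (Fin p)) :
    (multivariateGaussian 0 S).map (fun x => ⟪u, x⟫) =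
      gaussianReal 0 (quadForm S u).toNNReal := by
  have h := IsGaussian.map_eq_gaussianReal (μ := multivariateGaussian 0 S) (innerSL ℝ u)
  have hv : Var[innerSL ℝ u; multivariateGaussian 0 S] = quadForm S u := by
    have := covarianceBilin_multivariateGaussian (μ := 0) hS u u
    rw [covarianceBilin_apply_eq_cov IsGaussian.memLp_two_id, covariance_self (by fun_prop)] at this
    rw [quadForm, Matrix.inner_toEuclideanCLM, ← this]
    rfl
  have hm : ∫ x, innerSL ℝ u x ∂(multivariateGaussian 0 S) = 0 := by
    rw [(innerSL ℝ u).integral_comp_id_comm IsGaussian.integrable_id]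
    simp
  rw [hv, hm] at h
  exact h

theorem integral_inner_sq (hS : S.PosSemidef) (u : EuclideanSpace ℝ (Fin p)) :
    ∫ x, ⟪u, x⟫ ^ 2 ∂(multivariateGaussian 0 S) = quadForm S u := by
  have h : ∫ x, x ^ 2 ∂((multivariateGaussian 0 S).map (fun x => ⟪u, x⟫)) = quadForm S u := by
    rw [map_inner_multivariateGaussian hS]
    have := variance_fun_id_gaussianReal (μ := 0) (v := (quadForm S u).toNNReal)
    rw [variance_eq_integral (by fun_prop)] at this
    simpa [quadForm_nonneg hS u] using this
  rw [integral_map (by fun_prop) (by fun_prop)] at h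
  exact h

theorem integral_inner_pow_four (hS : S.PosSemidef) (u : EuclideanSpace ℝ (Fin p)) :
    ∫ x, ⟪u, x⟫ ^ 4 ∂(multivariateGaussian 0 S) = 3 * quadForm S u ^ 2 := by
  have h : ∫ x, x ^ 4 ∂((multivariateGaussian 0 S).map (fun x => ⟪u, x⟫)) =
      3 * quadForm S u ^ 2 := by
    rw [map_inner_multivariateGaussian hS, integral_pow_four_gaussianReal,
      Real.coe_toNNReal _ (quadForm_nonneg hS u)]
  rw [integral_map (by fun_prop) (by fun_prop)] at h
  exact h

theorem integrable_norm_pow_four :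
    Integrable (fun x => ‖x‖ ^ 4) (multivariateGaussian 0 S) := by
  have h := IsGaussian.memLp_id (multivariateGaussian 0 S) (4 : ℕ) (by simp)
  exact h.integrable_norm_pow (by simp)

theorem memLp_two_of_le_norm_sq {f : EuclideanSpace ℝ (Fin p) → ℝ} (hf : Measurable f) {K : ℝ}
    (h : ∀ x, |f x| ≤ K * ‖x‖ ^ 2) : MemLp f 2 (multivariateGaussian 0 S) := by
  rw [memLp_two_iff_integrable_sq hf.aestronglyMeasurable]
  refine (integrable_norm_pow_four.const_mul (K ^ 2)).mono' (by fun_prop) (ae_of_all _ fun x => ?_)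
  rw [Real.norm_eq_abs, abs_pow]
  calc |f x| ^ 2 ≤ (K * ‖x‖ ^ 2) ^ 2 := pow_le_pow_left₀ (abs_nonneg _) (h x) 2
    _ = K ^ 2 * ‖x‖ ^ 4 := by ring

theorem abs_inner_sq_le (u x : EuclideanSpace ℝ (Fin p)) : |⟪u, x⟫ ^ 2| ≤ ‖u‖ ^ 2 * ‖x‖ ^ 2 := by
  rw [abs_pow, ← mul_pow]
  exact pow_le_pow_left₀ (abs_nonneg _) (abs_real_inner_le_norm u x) 2

theorem abs_apply_mul_le (i j : Fin p) (x : EuclideanSpace ℝ (Fin p)) :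
    |x i * x j| ≤ 1 * ‖x‖ ^ 2 := by
  rw [abs_mul, one_mul, sq]
  exact mul_le_mul (PiLp.norm_apply_le x i) (PiLp.norm_apply_le x j) (abs_nonneg _) (norm_nonneg _)

theorem memLp_two_inner_sq (u : EuclideanSpace ℝ (Fin p)) :
    MemLp (fun x => ⟪u, x⟫ ^ 2) 2 (multivariateGaussian 0 S) :=
  memLp_two_of_le_norm_sq (by fun_prop) (abs_inner_sq_le u)

theorem memLp_two_apply_mul (i j : Fin p) :
    MemLp (fun x : EuclideanSpace ℝ (Fin p) => x i * x j) 2 (multivariateGaussian 0 S) :=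
  memLp_two_of_le_norm_sq (by fun_prop) (abs_apply_mul_le i j)

theorem memLp_two_norm_sq :
    MemLp (fun x : EuclideanSpace ℝ (Fin p) => ‖x‖ ^ 2) 2 (multivariateGaussian 0 S) :=
  memLp_two_of_le_norm_sq (K := 1) (by fun_prop) fun x => by simp

theorem variance_inner_sq (hS : S.PosSemidef) (u : EuclideanSpace ℝ (Fin p)) :
    Var[fun x => ⟪u, x⟫ ^ 2; multivariateGaussian 0 S] = 2 * quadForm S u ^ 2 := by
  rw [variance_eq_sub (memLp_two_inner_sq u), integral_inner_sq hS]
  have : ∫ x, ((fun x => ⟪u, x⟫ ^ 2) ^ 2) x ∂(multivariateGaussian 0 S) = 3 * quadForm S u ^ 2 := by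
    rw [← integral_inner_pow_four hS]
    exact integral_congr_ae (ae_of_all _ fun x => by simp only [Pi.pow_apply]; ring)
  rw [this]
  ring

theorem integral_apply_mul (hS : S.PosSemidef) (i j : Fin p) :
    ∫ x : EuclideanSpace ℝ (Fin p), x i * x j ∂(multivariateGaussian 0 S) = S i j := by
  have h := covariance_eval_multivariateGaussian (μ := 0) hS i j
  have h0 : ∀ i : Fin p, ∫ x : EuclideanSpace ℝ (Fin p), x i ∂(multivariateGaussian 0 S) = 0 := by
    intro i
    have := (EuclideanSpace.proj (𝕜 := ℝ) i).integral_comp_id_comm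
      (IsGaussian.integrable_id (μ := multivariateGaussian 0 S))
    simpa using this
  rw [covariance, h0, h0] at h
  simpa using h

theorem inner_single_add_mul (i j : Fin p) (r : ℝ) (x : EuclideanSpace ℝ (Fin p)) :
    ⟪EuclideanSpace.single i (1 : ℝ) + r • EuclideanSpace.single j (1 : ℝ), x⟫ =
      x i + r * x j := by
  simp [inner_add_left, inner_smul_left, EuclideanSpace.inner_single_left]

theorem integral_apply_sq_mul_apply_sq (hS : S.PosSemidef) (i j : Fin p) :
    ∫ x : EuclideanSpace ℝ (Fin p), (x i * x j) ^ 2 ∂(multivariateGaussian 0 S) =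
      S i i * S j j + 2 * S i j ^ 2 := by
  set N := multivariateGaussian (0 : EuclideanSpace ℝ (Fin p)) S
  have hint : ∀ u : EuclideanSpace ℝ (Fin p), Integrable (fun x => ⟪u, x⟫ ^ 4) N := by
    intro u
    refine (memLp_two_inner_sq u).integrable_sq.congr (ae_of_all _ fun x => ?_)
    ring
  have hq : ∀ r : ℝ, quadForm S (EuclideanSpace.single i (1 : ℝ) + r • EuclideanSpace.single j 1) =
      S i i + 2 * r * S i j + r ^ 2 * S j j := by
    intro r
    rw [← integral_inner_sq hS]
    simp_rw [inner_single_add_mul]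
    have e : ∀ x : EuclideanSpace ℝ (Fin p), (x i + r * x j) ^ 2 =
        x i * x i + 2 * r * (x i * x j) + r ^ 2 * (x j * x j) := fun x => by ring
    simp_rw [e]
    have hI : ∀ i j : Fin p, Integrable (fun x : EuclideanSpace ℝ (Fin p) => x i * x j) N :=
      fun i j => (memLp_two_apply_mul i j).integrable (by simp)
    rw [integral_add ((hI i i).fun_add ((hI i j).const_mul _)) ((hI j j).const_mul _),
      integral_add (hI i i) ((hI i j).const_mul _), integral_const_mul, integral_const_mul,
      integral_apply_mul hS, integral_apply_mul hS, integral_apply_mul hS]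
  have h4 : ∀ r : ℝ, Integrable (fun x : EuclideanSpace ℝ (Fin p) => (x i + r * x j) ^ 4) N ∧
      ∫ x : EuclideanSpace ℝ (Fin p), (x i + r * x j) ^ 4 ∂N =
      3 * (S i i + 2 * r * S i j + r ^ 2 * S j j) ^ 2 := by
    intro r
    have h1 := hint (EuclideanSpace.single i (1 : ℝ) + r • EuclideanSpace.single j 1)
    have h2 := integral_inner_pow_four hS
      (EuclideanSpace.single i (1 : ℝ) + r • EuclideanSpace.single j 1)
    simp_rw [inner_single_add_mul] at h1 h2
    rw [hq] at h2
    exact ⟨h1, h2⟩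
  have h4' : ∀ j : Fin p, Integrable (fun x : EuclideanSpace ℝ (Fin p) => x j ^ 4) N ∧
      ∫ x : EuclideanSpace ℝ (Fin p), x j ^ 4 ∂N = 3 * S j j ^ 2 := by
    intro j
    have hx : ∀ x : EuclideanSpace ℝ (Fin p), x j ^ 4 = (x j * x j) ^ 2 := fun x => by ring
    have h1 := hint (EuclideanSpace.single j (1 : ℝ))
    have h2 := integral_inner_pow_four hS (EuclideanSpace.single j (1 : ℝ))
    rw [← integral_inner_sq hS] at h2
    simp only [EuclideanSpace.inner_single_left, map_one, one_mul] at h1 h2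
    refine ⟨h1, h2.trans ?_⟩
    rw [← integral_apply_mul hS j j]
    simp_rw [sq]
  -- Polarisation reduces the mixed fourth moment to fourth moments of one-dimensional projections.
  have e : ∀ x : EuclideanSpace ℝ (Fin p), (x i * x j) ^ 2 = (1 / 12) *
      (((x i + 1 * x j) ^ 4 + (x i + (-1) * x j) ^ 4) - (2 * x i ^ 4 + 2 * x j ^ 4)) :=
    fun x => by ring
  simp_rw [e]
  rw [integral_const_mul, integral_sub ((h4 1).1.fun_add (h4 (-1)).1)
    (((h4' i).1.const_mul 2).fun_add ((h4' j).1.const_mul 2)), integral_add (h4 1).1 (h4 (-1)).1,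
    integral_add ((h4' i).1.const_mul 2) ((h4' j).1.const_mul 2), integral_const_mul,
    integral_const_mul, (h4 1).2, (h4 (-1)).2, (h4' i).2, (h4' j).2]
  ring

theorem integral_norm_sq (hS : S.PosSemidef) :
    ∫ x, ‖x‖ ^ 2 ∂(multivariateGaussian 0 S) = S.trace := by
  simp_rw [EuclideanSpace.real_norm_sq_eq, sq]
  rw [integral_finsetSum _ fun i _ => (memLp_two_apply_mul i i).integrable (by simp)]
  simp_rw [integral_apply_mul hS]
  rfl

theorem sum_integral_apply_mul_sq (hS : S.PosSemidef) :
    ∑ i, ∑ j, ∫ x : EuclideanSpace ℝ (Fin p), (x i * x j) ^ 2 ∂(multivariateGaussian 0 S) =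
      S.trace ^ 2 + 2 * frobNorm S ^ 2 := by
  simp_rw [integral_apply_sq_mul_apply_sq hS, Finset.sum_add_distrib, frobNorm_sq, ← Finset.mul_sum,
    ← Finset.sum_mul]
  rw [sq]
  rfl

theorem variance_norm_sq (hS : S.PosSemidef) :
    Var[fun x => ‖x‖ ^ 2; multivariateGaussian 0 S] = 2 * frobNorm S ^ 2 := by
  rw [variance_eq_sub memLp_two_norm_sq, integral_norm_sq hS]
  have : ∫ x, ((fun x => ‖x‖ ^ 2) ^ 2) x ∂(multivariateGaussian 0 S) =
      S.trace ^ 2 + 2 * frobNorm S ^ 2 := by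
    rw [← sum_integral_apply_mul_sq hS]
    have e : ∀ x : EuclideanSpace ℝ (Fin p), ((fun x => ‖x‖ ^ 2) ^ 2) x =
        ∑ i, ∑ j, (x i * x j) ^ 2 := by
      intro x
      simp only [Pi.pow_apply, EuclideanSpace.real_norm_sq_eq, mul_pow]
      rw [sq, Finset.sum_mul_sum]
    simp_rw [e]
    have hI : ∀ i j : Fin p, Integrable (fun x : EuclideanSpace ℝ (Fin p) => (x i * x j) ^ 2)
      (multivariateGaussian 0 S) := fun i j => (memLp_two_apply_mul i j).integrable_sq
    rw [integral_finsetSum _ fun i _ => integrable_finsetSum _ fun j _ => hI i j]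
    exact Finset.sum_congr rfl fun i _ => integral_finsetSum _ fun j _ => hI i j
  rw [this]
  ring

end GaussianMoments

/-! ### Exponential moments of a centred Gaussian vector. -/

section GaussianExponential

open scoped MatrixOrder

variable {p : ℕ} {S : Matrix (Fin p) (Fin p) ℝ}

theorem lintegral_exp_inner_sq_le (hS : S.PosSemidef) (u : EuclideanSpace ℝ (Fin p)) {s : ℝ}
    (hs : 0 ≤ s) (hsu : s * quadForm S u ≤ 1 / 4) :
    ∫⁻ x, ENNReal.ofReal (Real.exp (s * ⟪u, x⟫ ^ 2)) ∂(multivariateGaussian 0 S) ≤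
      ENNReal.ofReal (Real.exp (s * quadForm S u + 2 * (s * quadForm S u) ^ 2)) := by
  have hq := quadForm_nonneg hS u
  have h := lintegral_exp_mul_sq_gaussianReal_le (mul_nonneg hs hq) hsu
  refine le_trans (le_of_eq ?_) h
  have h1 : ∫⁻ x, ENNReal.ofReal (Real.exp (s * x ^ 2))
      ∂((multivariateGaussian 0 S).map (fun x => ⟪u, x⟫)) =
      ∫⁻ x, ENNReal.ofReal (Real.exp (s * ⟪u, x⟫ ^ 2)) ∂(multivariateGaussian 0 S) :=
    lintegral_map (by fun_prop) (by fun_prop)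
  have h2 : gaussianReal 0 (quadForm S u).toNNReal =
      (gaussianReal 0 1).map (Real.sqrt (quadForm S u) * ·) := by
    rw [gaussianReal_map_const_mul]
    congr 1
    · simp
    · ext
      simp [Real.sq_sqrt hq, hq]
  rw [← h1, map_inner_multivariateGaussian hS, h2, lintegral_map (by fun_prop) (by fun_prop)]
  refine lintegral_congr fun x => ?_
  rw [mul_pow, Real.sq_sqrt hq]
  ring_nf

/-- In the eigenbasis `‖x‖²` has the law of `∑ λᵢ ξᵢ²` with independent standard normal `ξᵢ`, so the
integral factors and the scalar bound applies with `s λᵢ ≤ 1/4`. -/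
theorem lintegral_exp_norm_sq_le (hS : S.PosSemidef) {s : ℝ} (hs : 0 ≤ s)
    (hsO : s * opNorm S ≤ 1 / 4) :
    ∫⁻ x, ENNReal.ofReal (Real.exp (s * ‖x‖ ^ 2)) ∂(multivariateGaussian 0 S) ≤
      ENNReal.ofReal (Real.exp (s * S.trace + 2 * s ^ 2 * frobNorm S ^ 2)) := by
  have hH := hS.isHermitian
  have hn : ∀ x : EuclideanSpace ℝ (Fin p),
      ‖Matrix.toEuclideanCLM (𝕜 := ℝ) (CFC.sqrt S) x‖ ^ 2 = quadForm S x := by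
    intro x
    have hsa : IsSelfAdjoint (Matrix.toEuclideanCLM (𝕜 := ℝ) (CFC.sqrt S)) :=
      (CFC.sqrt_nonneg S).isSelfAdjoint.map _
    have hsq : CFC.sqrt S * CFC.sqrt S = S := CFC.sqrt_mul_sqrt_self _ hS.nonneg
    rw [← real_inner_self_eq_norm_sq, quadForm]
    conv_lhs => rw [← hsa.adjoint_eq, ContinuousLinearMap.adjoint_inner_left, hsa.adjoint_eq]
    rw [← ContinuousLinearMap.comp_apply, ← ContinuousLinearMap.mul_def, ← map_mul, hsq]
  rw [multivariateGaussian, lintegral_map (by fun_prop) (by fun_prop)]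
  have h0 : ∀ x : EuclideanSpace ℝ (Fin p),
      ‖0 + Matrix.toEuclideanCLM (𝕜 := ℝ) (CFC.sqrt S) x‖ ^ 2 = quadForm S x := fun x => by
    rw [zero_add, hn]
  simp_rw [h0]
  rw [stdGaussian_eq_map_pi_orthonormalBasis hH.eigenvectorBasis,
    lintegral_map (by unfold quadForm; fun_prop) (by fun_prop)]
  have h1 : ∀ ξ : Fin p → ℝ, ENNReal.ofReal (Real.exp (s * quadForm S
      (∑ i, ξ i • hH.eigenvectorBasis i))) =
      ∏ i, ENNReal.ofReal (Real.exp (s * hH.eigenvalues i * ξ i ^ 2)) := by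
    intro ξ
    rw [← ENNReal.ofReal_prod_of_nonneg fun i _ => (Real.exp_pos _).le, ← Real.exp_sum,
      quadForm_eq_sum_eigenvalues hH, Finset.mul_sum]
    congr 2
    refine Finset.sum_congr rfl fun i _ => ?_
    rw [inner_sum]
    simp only [inner_smul_right, orthonormal_iff_ite.1 hH.eigenvectorBasis.orthonormal]
    simp [mul_assoc]
  simp_rw [h1]
  rw [lintegral_pi_prod (fun _ => gaussianReal 0 1)
    (fun i x => ENNReal.ofReal (Real.exp (s * hH.eigenvalues i * x ^ 2))) (by fun_prop)]
  calc _ ≤ ∏ i, ENNReal.ofReal (Real.exp (s * hH.eigenvalues i +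
        2 * (s * hH.eigenvalues i) ^ 2)) := by
        refine Finset.prod_le_prod' fun i _ => ?_
        refine lintegral_exp_mul_sq_gaussianReal_le (mul_nonneg hs (hS.eigenvalues_nonneg i)) ?_
        exact (mul_le_mul_of_nonneg_left ((le_abs_self _).trans
          (abs_eigenvalues_le_opNorm hH i)) hs).trans hsO
    _ = _ := by
        rw [← ENNReal.ofReal_prod_of_nonneg fun i _ => (Real.exp_pos _).le, ← Real.exp_sum,
          Finset.sum_add_distrib, ← Finset.mul_sum, ← sum_eigenvalues_sq hH,
          hH.trace_eq_sum_eigenvalues, Finset.mul_sum (a := 2 * s ^ 2)]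
        congr 3
        exact Finset.sum_congr rfl fun i _ => by ring

end GaussianExponential

end Changepoint

/-! ### Norm tails, the noise law, and block estimators. -/

namespace Changepoint

open scoped NNReal ENNReal RealInnerProductSpace

variable {p n : ℕ} {S : Matrix (Fin p) (Fin p) ℝ}

theorem measureReal_norm_sq_ge_le (hS : S.PosSemidef) (hF : 0 < frobNorm S) (hO : 0 < opNorm S)
    {L K : ℝ} (hL : 0 < L) (hK : 0 ≤ K) :
    (multivariateGaussian 0 S).real {x | S.trace +
      K * max (frobNorm S * Real.sqrt L) (opNorm S * L) ≤ ‖x‖ ^ 2} ≤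
      Real.exp (L / 8 - K * (L / 4)) := by
  set F := frobNorm S
  set O := opNorm S
  set R := max (F * Real.sqrt L) (O * L) with hR
  have hsL : 0 < Real.sqrt L := Real.sqrt_pos.2 hL
  -- The Chernoff parameter is `s = min (√L / F) (1 / O) / 4`. Then `2 s² F² ≤ L/8`, while the
  -- excess over the trace contributes at least `K L / 4`.
  obtain ⟨s, hs0, hsO, hsF, hsR⟩ : ∃ s : ℝ, 0 < s ∧ s * O ≤ 1 / 4 ∧ s * F ≤ Real.sqrt L / 4 ∧
      L / 4 ≤ s * R := by
    rcases le_total (Real.sqrt L / F) (1 / O) with h | h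
    · refine ⟨Real.sqrt L / F / 4, by positivity, ?_, ?_, ?_⟩
      · have := mul_le_mul_of_nonneg_right h hO.le
        rw [one_div, inv_mul_cancel₀ hO.ne'] at this
        linarith
      · rw [div_div, div_mul_eq_mul_div, mul_comm F 4, mul_div_mul_right _ _ hF.ne']
      · have : Real.sqrt L / F / 4 * (F * Real.sqrt L) = L / 4 := by
          have := Real.mul_self_sqrt hL.le
          field_simp
          linarith
        rw [← this]
        exact mul_le_mul_of_nonneg_left (le_max_left _ _) (by positivity)
    · refine ⟨1 / O / 4, by positivity, ?_, ?_, ?_⟩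
      · apply le_of_eq; field_simp
      · have := mul_le_mul_of_nonneg_right h hF.le
        rw [div_mul_cancel₀ _ hF.ne'] at this
        linarith
      · have : 1 / O / 4 * (O * L) = L / 4 := by field_simp
        rw [← this]
        exact mul_le_mul_of_nonneg_left (le_max_right _ _) (by positivity)
  have h1 := lintegral_exp_norm_sq_le hS hs0.le hsO
  set c : ℝ := S.trace + K * R
  have h2 : multivariateGaussian 0 S {x | c ≤ ‖x‖ ^ 2} ≤
      ENNReal.ofReal (Real.exp (s * S.trace + 2 * s ^ 2 * F ^ 2)) /
        ENNReal.ofReal (Real.exp (s * c)) := by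
    refine (measure_mono fun x hx => ?_).trans ((meas_ge_le_lintegral_div
      (f := fun x => ENNReal.ofReal (Real.exp (s * ‖x‖ ^ 2))) (by fun_prop)
      (ε := ENNReal.ofReal (Real.exp (s * c))) (by simp [Real.exp_pos]) (by simp)).trans
      (ENNReal.div_le_div_right h1 _))
    exact ENNReal.ofReal_le_ofReal (Real.exp_le_exp.2 (mul_le_mul_of_nonneg_left hx hs0.le))
  rw [← ENNReal.ofReal_div_of_pos (Real.exp_pos _), ← Real.exp_sub] at h2
  refine (ENNReal.toReal_le_of_le_ofReal (Real.exp_pos _).le h2).trans (Real.exp_le_exp.2 ?_)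
  have h3 : (s * F) ^ 2 ≤ L / 16 := by
    have := pow_le_pow_left₀ (by positivity) hsF 2
    rw [div_pow, Real.sq_sqrt hL.le] at this
    linarith
  have h4 := mul_le_mul_of_nonneg_left hsR hK
  simp only [c]
  nlinarith

/-- The law of `n` independent centred Gaussian columns. -/
noncomputable abbrev noiseLaw (n : ℕ) (S : Matrix (Fin p) (Fin p) ℝ) : Measure (Columns p n) :=
  Measure.pi fun _ => multivariateGaussian 0 S

theorem multivariateGaussian_eq_map_add (μ : EuclideanSpace ℝ (Fin p)) :
    multivariateGaussian μ S = (multivariateGaussian 0 S).map (fun x => μ + x) := by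
  rw [multivariateGaussian, multivariateGaussian, Measure.map_map (by fun_prop) (by fun_prop)]
  congr 1
  ext x
  simp

theorem dataLaw_eq_map (S : Matrix (Fin p) (Fin p) ℝ) (θ : Columns p n) :
    dataLaw S θ = (noiseLaw n S).map (fun Z => θ + Z) := by
  rw [dataLaw, noiseLaw]
  simp_rw [multivariateGaussian_eq_map_add (θ _)]
  rw [← Measure.pi_map_pi (fun t => by fun_prop)]
  rfl

/-- The characteristic functions multiply and the exponents carry the factors `a t ^ 2`. This gives
the laws of both the normalised block sums and the statistics `Y_t`. -/
theorem map_sum_smul_noiseLaw (hS : S.PosSemidef) (a : Fin n → ℝ) (ha : ∑ t, a t ^ 2 = 1) :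
    (noiseLaw n S).map (fun Z => ∑ t, a t • Z t) = multivariateGaussian 0 S := by
  have h1 : (noiseLaw n S).map (fun Z => ∑ t, a t • Z t) =
      (Measure.pi fun t => (multivariateGaussian 0 S).map (fun x => a t • x)).map
        (fun Z => ∑ t, Z t) := by
    rw [← Measure.pi_map_pi (fun t => by fun_prop), Measure.map_map (by fun_prop) (by fun_prop)]
    rfl
  have : ∀ t, IsProbabilityMeasure ((multivariateGaussian 0 S).map (fun x => a t • x)) :=
    fun t => Measure.isProbabilityMeasure_map (by fun_prop)
  apply Measure.ext_of_charFun
  rw [h1, charFun_map_sum_pi_eq_prod]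
  ext u
  rw [Finset.prod_apply]
  simp_rw [charFun_map_smul, charFun_multivariateGaussian hS]
  rw [← Complex.exp_sum]
  congr 1
  have h2 : ∀ t, ((((a t • u).ofLp ⬝ᵥ S.mulVec (a t • u).ofLp : ℝ)) : ℂ) =
      ((a t ^ 2 : ℝ) : ℂ) * ((u.ofLp ⬝ᵥ S.mulVec u.ofLp : ℝ) : ℂ) := by
    intro t
    rw [← Complex.ofReal_mul]
    congr 1
    rw [WithLp.ofLp_smul, Matrix.mulVec_smul, smul_dotProduct, dotProduct_smul]
    simp only [smul_eq_mul]
    ring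
  simp_rw [h2, inner_zero_right, Complex.ofReal_zero, zero_mul, zero_sub, ← neg_div,
    ← neg_mul]
  rw [← Finset.sum_div, ← Finset.sum_mul, Finset.sum_neg_distrib, ← Complex.ofReal_sum, ha]
  simp

/-- The sum of the columns in a block, normalised to have the law of one column of noise. -/
noncomputable def blockSum (D : Finset (Fin n)) (Z : Columns p n) : EuclideanSpace ℝ (Fin p) :=
  (Real.sqrt D.card)⁻¹ • ∑ t ∈ D, Z t

@[fun_prop]
theorem measurable_blockSum (D : Finset (Fin n)) :
    Measurable (blockSum D : Columns p n → EuclideanSpace ℝ (Fin p)) := by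
  unfold blockSum; fun_prop

theorem measurePreserving_blockSum (hS : S.PosSemidef) {D : Finset (Fin n)} (hD : 0 < D.card) :
    MeasurePreserving (blockSum D) (noiseLaw n S) (multivariateGaussian 0 S) := by
  refine ⟨by fun_prop, ?_⟩
  have h := map_sum_smul_noiseLaw (n := n) hS
    (fun t => if t ∈ D then (Real.sqrt D.card)⁻¹ else 0) (by
      have h0 : (0 : ℝ) < D.card := by exact_mod_cast hD
      simp [Real.sq_sqrt h0.le, ite_pow, h0.ne'])
  rw [← h]
  congr 1
  ext1 Z
  simp [blockSum, Finset.smul_sum, ite_smul]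

/-- The unbiased block estimator of the mean of a quadratic functional of the noise. -/
noncomputable def blockEstimator (f : EuclideanSpace ℝ (Fin p) → ℝ) (D : Finset (Fin n))
    (Z : Columns p n) : ℝ :=
  ((D.card : ℝ) - 1)⁻¹ * (∑ t ∈ D, f (Z t) - f (blockSum D Z))

/-- The normalised block sum has the law of one column, so with `m = D.card` the numerator has mean
`(m - 1) E f`. Its two centred parts have variances `m Var f`, by independence, and `Var f`; they
are dependent on each other, so `(x - y)² ≤ 2x² + 2y²` is used in place of a covariance. -/
theorem blockEstimator_sq_error (hS : S.PosSemidef) {f : EuclideanSpace ℝ (Fin p) → ℝ}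
    (hf : MemLp f 2 (multivariateGaussian 0 S)) {D : Finset (Fin n)} (hD : 1 < D.card) :
    Integrable (fun Z => (blockEstimator f D Z - ∫ x, f x ∂(multivariateGaussian 0 S)) ^ 2)
      (noiseLaw n S) ∧
    ∫ Z, (blockEstimator f D Z - ∫ x, f x ∂(multivariateGaussian 0 S)) ^ 2 ∂(noiseLaw n S) ≤
      2 * (D.card + 1) / ((D.card : ℝ) - 1) ^ 2 * Var[f; multivariateGaussian 0 S] := by
  set N := multivariateGaussian 0 S
  set P := noiseLaw n S
  set a := ∫ x, f x ∂N with ha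
  set m : ℝ := (D.card : ℝ) with hm
  have hm1 : (1 : ℝ) < m := Nat.one_lt_cast.2 hD
  have hft : ∀ t, MemLp (fun Z : Columns p n => f (Z t)) 2 P := fun t =>
    hf.comp_measurePreserving (measurePreserving_eval _ t)
  have hW := measurePreserving_blockSum (n := n) hS (zero_lt_one.trans hD)
  have hfW : MemLp (fun Z : Columns p n => f (blockSum D Z)) 2 P := hf.comp_measurePreserving hW
  have hA : MemLp (fun Z : Columns p n => ∑ t ∈ D, f (Z t) - m * a) 2 P :=
    (memLp_finsetSum D fun t _ => hft t).sub (memLp_const _)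
  have hB : MemLp (fun Z : Columns p n => f (blockSum D Z) - a) 2 P := hfW.sub (memLp_const _)
  have hcomp : ∀ {g : Columns p n → EuclideanSpace ℝ (Fin p)}, MeasurePreserving g P N →
      ∫ Z, f (g Z) ∂P = a ∧ Var[fun Z => f (g Z); P] = Var[f; N] := by
    intro g hg
    have hf' : AEStronglyMeasurable f (P.map g) := by rw [hg.map_eq]; exact hf.aestronglyMeasurable
    constructor
    · rw [← integral_map hg.measurable.aemeasurable hf', hg.map_eq]
    · have := variance_map (μ := P) (Y := g) hf'.aemeasurable hg.measurable.aemeasurable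
      rw [hg.map_eq] at this
      exact this.symm
  have hA2 : ∫ Z, (∑ t ∈ D, f (Z t) - m * a) ^ 2 ∂P = m * Var[f; N] := by
    have hvar : Var[∑ t ∈ D, fun Z : Columns p n => f (Z t); P] = m * Var[f; N] := by
      rw [IndepFun.variance_sum (fun t _ => hft t)]
      · rw [Finset.sum_congr rfl fun t _ => (hcomp (measurePreserving_eval _ t)).2]
        simp [hm]
      · intro i _ j _ hij
        exact (iIndepFun_pi (X := fun _ : Fin n => f)
          fun _ => hf.aestronglyMeasurable.aemeasurable).indepFun hij
    rw [variance_eq_integral (Finset.aemeasurable_sum _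
      fun t _ => (hft t).aestronglyMeasurable.aemeasurable)] at hvar
    have hmean : ∫ Z, (∑ t ∈ D, fun Z : Columns p n => f (Z t)) Z ∂P = m * a := by
      simp_rw [Finset.sum_apply]
      rw [integral_finsetSum _ fun t _ => (hft t).integrable (by simp),
        Finset.sum_congr rfl fun t _ => (hcomp (measurePreserving_eval _ t)).1]
      simp [hm]
    rw [hmean] at hvar
    simpa using hvar
  have hB2 : ∫ Z, (f (blockSum D Z) - a) ^ 2 ∂P = Var[f; N] := by
    rw [← (hcomp hW).2, variance_eq_integral hfW.aestronglyMeasurable.aemeasurable, (hcomp hW).1]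
  have hG : ∀ Z : Columns p n, blockEstimator f D Z - a =
      (m - 1)⁻¹ * ((∑ t ∈ D, f (Z t) - m * a) - (f (blockSum D Z) - a)) := by
    intro Z
    have : m - 1 ≠ 0 := by linarith
    rw [blockEstimator, ← hm]
    field_simp
    ring
  have hGL : MemLp (fun Z => blockEstimator f D Z - a) 2 P := by
    simp_rw [hG]
    exact (hA.sub hB).const_mul _
  refine ⟨hGL.integrable_sq, ?_⟩
  calc ∫ Z, (blockEstimator f D Z - a) ^ 2 ∂P
      ≤ ∫ Z, ((m - 1) ^ 2)⁻¹ * (2 * (∑ t ∈ D, f (Z t) - m * a) ^ 2 +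
          2 * (f (blockSum D Z) - a) ^ 2) ∂P := by
        refine integral_mono hGL.integrable_sq
          (((hA.integrable_sq.const_mul 2).add (hB.integrable_sq.const_mul 2)).const_mul _)
          fun Z => ?_
        simp only [hG Z, mul_pow, inv_pow]
        refine mul_le_mul_of_nonneg_left ?_ (by positivity)
        nlinarith [sq_nonneg ((∑ t ∈ D, f (Z t) - m * a) + (f (blockSum D Z) - a))]
    _ = 2 * (m + 1) / (m - 1) ^ 2 * Var[f; N] := by
        rw [integral_const_mul, integral_add (hA.integrable_sq.const_mul 2)
          (hB.integrable_sq.const_mul 2), integral_const_mul, integral_const_mul, hA2, hB2]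
        ring

end Changepoint

/-! ### Concentration of the sample covariance. -/

namespace Changepoint

open scoped NNReal ENNReal RealInnerProductSpace

variable {p n : ℕ} {S : Matrix (Fin p) (Fin p) ℝ}

theorem blockMean_add_of_const {D : Finset (Fin n)} (hD : 0 < D.card) {θ : Columns p n}
    {μ : EuclideanSpace ℝ (Fin p)} (hθ : ∀ t ∈ D, θ t = μ) (Z : Columns p n) :
    blockMean D (θ + Z) = μ + blockMean D Z := by
  have h0 : (D.card : ℝ) ≠ 0 := by exact_mod_cast hD.ne'
  simp only [blockMean, Pi.add_apply, Finset.sum_add_distrib, smul_add]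
  rw [Finset.sum_congr rfl hθ, Finset.sum_const, ← Nat.cast_smul_eq_nsmul ℝ, smul_smul,
    inv_mul_cancel₀ h0, one_smul]

theorem sampleCov_add_of_const {D : Finset (Fin n)} (hD : 0 < D.card) {θ : Columns p n}
    {μ : EuclideanSpace ℝ (Fin p)} (hθ : ∀ t ∈ D, θ t = μ) (Z : Columns p n) :
    sampleCov D (θ + Z) = sampleCov D Z := by
  rw [sampleCov, sampleCov, blockMean_add_of_const hD hθ]
  congr 1
  refine Finset.sum_congr rfl fun t ht => ?_
  rw [Pi.add_apply, hθ t ht, add_sub_add_left_eq_sub]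

/-- Expanding the centring subtracts `D.card` times the product of the mean's coordinates, which is
the product of the coordinates of `blockSum`. By linearity the trace and all quadratic forms are
block estimators too. -/
theorem sampleCov_apply {D : Finset (Fin n)} (hD : 0 < D.card) (Z : Columns p n) (i j : Fin p) :
    sampleCov D Z i j = blockEstimator (fun x => x i * x j) D Z := by
  have h0 : (D.card : ℝ) ≠ 0 := by exact_mod_cast hD.ne'
  have hs : (Real.sqrt D.card)⁻¹ * (Real.sqrt D.card)⁻¹ = (D.card : ℝ)⁻¹ := by
    rw [← mul_inv, Real.mul_self_sqrt (Nat.cast_nonneg _)]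
  have hsum : ∀ k : Fin p, (∑ t ∈ D, Z t).ofLp k = ∑ t ∈ D, Z t k := by
    intro k
    simp
  rw [sampleCov, blockEstimator, Matrix.smul_apply, Matrix.sum_apply, smul_eq_mul]
  congr 1
  simp only [Matrix.vecMulVec_apply, WithLp.ofLp_sub, Pi.sub_apply, blockMean, blockSum,
    WithLp.ofLp_smul, Pi.smul_apply, smul_eq_mul, hsum]
  set a := ∑ t ∈ D, Z t i
  set b := ∑ t ∈ D, Z t j
  have e : ∀ t, (Z t i - (D.card : ℝ)⁻¹ * a) * (Z t j - (D.card : ℝ)⁻¹ * b) =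
      Z t i * Z t j - (D.card : ℝ)⁻¹ * b * Z t i - (D.card : ℝ)⁻¹ * a * Z t j +
        (D.card : ℝ)⁻¹ * a * ((D.card : ℝ)⁻¹ * b) := fun t => by ring
  simp_rw [e]
  rw [Finset.sum_add_distrib, Finset.sum_sub_distrib, Finset.sum_sub_distrib, ← Finset.mul_sum,
    ← Finset.mul_sum, Finset.sum_const, nsmul_eq_mul,
    mul_mul_mul_comm (Real.sqrt (D.card : ℝ))⁻¹, hs]
  change _ - _ * b * a - _ * a * b + _ = _
  field_simp
  ring

theorem blockEstimator_sum {ι : Type*} (s : Finset ι) (f : ι → EuclideanSpace ℝ (Fin p) → ℝ)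
    (D : Finset (Fin n)) (Z : Columns p n) :
    blockEstimator (fun x => ∑ i ∈ s, f i x) D Z = ∑ i ∈ s, blockEstimator (f i) D Z := by
  simp only [blockEstimator]
  rw [← Finset.mul_sum, Finset.sum_sub_distrib, Finset.sum_comm]

theorem blockEstimator_const_mul (c : ℝ) (f : EuclideanSpace ℝ (Fin p) → ℝ)
    (D : Finset (Fin n)) (Z : Columns p n) :
    blockEstimator (fun x => c * f x) D Z = c * blockEstimator f D Z := by
  simp only [blockEstimator]
  rw [← Finset.mul_sum]
  ring

theorem trace_sampleCov {D : Finset (Fin n)} (hD : 0 < D.card) (Z : Columns p n) :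
    (sampleCov D Z).trace = blockEstimator (fun x => ‖x‖ ^ 2) D Z := by
  simp_rw [EuclideanSpace.real_norm_sq_eq, sq]
  rw [blockEstimator_sum, Matrix.trace]
  exact Finset.sum_congr rfl fun i _ => sampleCov_apply hD Z i i

theorem quadForm_sampleCov {D : Finset (Fin n)} (hD : 0 < D.card) (Z : Columns p n)
    (u : EuclideanSpace ℝ (Fin p)) :
    quadForm (sampleCov D Z) u = blockEstimator (fun x => ⟪u, x⟫ ^ 2) D Z := by
  have e : (fun x : EuclideanSpace ℝ (Fin p) => ⟪u, x⟫ ^ 2) =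
      fun x => ∑ i, ∑ j, u i * u j * (x i * x j) := by
    ext x
    rw [PiLp.inner_apply, sq, Finset.sum_mul_sum]
    refine Finset.sum_congr rfl fun i _ => Finset.sum_congr rfl fun j _ => ?_
    simp only [RCLike.inner_apply, conj_trivial]
    ring
  rw [e, blockEstimator_sum, quadForm_eq_sum]
  refine Finset.sum_congr rfl fun i _ => ?_
  rw [blockEstimator_sum]
  refine Finset.sum_congr rfl fun j _ => ?_
  rw [blockEstimator_const_mul, sampleCov_apply hD]
  ring

theorem posSemidef_sampleCov {D : Finset (Fin n)} (hD : 0 < D.card) (Z : Columns p n) :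
    (sampleCov D Z).PosSemidef := by
  rw [sampleCov]
  refine Matrix.PosSemidef.smul ?_ ?_
  · refine Matrix.posSemidef_sum _ fun t _ => ?_
    have := Matrix.posSemidef_vecMulVec_self_star (Z t - blockMean D Z).ofLp
    simpa using this
  · have : (1 : ℝ) ≤ D.card := by exact_mod_cast hD
    exact inv_nonneg.2 (by linarith)

/-- Dropping the centring term leaves a sum over independent columns, whose exponential moment
factors. -/
theorem quadForm_sampleCov_le {D : Finset (Fin n)} (hD : 1 < D.card) (Z : Columns p n)
    (u : EuclideanSpace ℝ (Fin p)) :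
    ((D.card : ℝ) - 1) * quadForm (sampleCov D Z) u ≤ ∑ t ∈ D, ⟪u, Z t⟫ ^ 2 := by
  have h : (0 : ℝ) < D.card - 1 := by
    have : (1 : ℝ) < D.card := by exact_mod_cast hD
    linarith
  rw [quadForm_sampleCov (zero_lt_one.trans hD), blockEstimator, mul_inv_cancel_left₀ h.ne']
  have := sq_nonneg ⟪u, blockSum D Z⟫
  linarith

theorem frobNorm_eq_norm (M : Matrix (Fin p) (Fin p) ℝ) :
    frobNorm M = ‖(WithLp.toLp 2 fun q : Fin p × Fin p => M q.1 q.2 :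
      EuclideanSpace ℝ (Fin p × Fin p))‖ := by
  rw [frobNorm, EuclideanSpace.norm_eq, Fintype.sum_prod_type]
  simp

theorem abs_frobNorm_sub_le (M N : Matrix (Fin p) (Fin p) ℝ) :
    |frobNorm M - frobNorm N| ≤ frobNorm (M - N) := by
  simp only [frobNorm_eq_norm]
  exact abs_norm_sub_norm_le _ _

theorem measureReal_le_of_integral_le {Ω : Type*} [MeasurableSpace Ω] {P : Measure Ω}
    [IsFiniteMeasure P] {f : Ω → ℝ} (hf : Integrable f P) (hf0 : ∀ x, 0 ≤ f x) {B c : ℝ}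
    (hB : ∫ x, f x ∂P ≤ B) (hc : 0 < c) {s : Set Ω} (hs : ∀ x ∈ s, c ≤ f x) :
    P.real s ≤ B / c := by
  rw [le_div_iff₀ hc, mul_comm]
  refine le_trans ?_ hB
  refine le_trans ?_ (mul_meas_ge_le_integral_of_nonneg (ae_of_all _ hf0) hf c)
  exact mul_le_mul_of_nonneg_left (measureReal_mono hs) hc.le

/-- Equivalent to `m² - 5m + 2 ≥ 0`, whose larger root lies below `5`. -/
theorem error_factor_le {m : ℝ} (hm : 5 ≤ m) : 2 * (m + 1) / (m - 1) ^ 2 ≤ 4 / m := by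
  rw [div_le_div_iff₀ (by nlinarith) (by linarith)]
  nlinarith

variable {D : Finset (Fin n)}

theorem measureReal_trace_sampleCov (hS : S.PosSemidef) (hF : 0 < frobNorm S) (hD : 5 ≤ D.card) :
    (noiseLaw n S).real {Z | frobNorm S < |(sampleCov D Z).trace - S.trace|} ≤ 8 / D.card := by
  have hD' : (5 : ℝ) ≤ D.card := by exact_mod_cast hD
  have h := blockEstimator_sq_error (n := n) hS memLp_two_norm_sq (D := D) (by lia)
  rw [integral_norm_sq hS, variance_norm_sq hS] at h
  refine (measureReal_le_of_integral_le h.1 (fun _ => sq_nonneg _) (h.2.trans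
    (mul_le_mul_of_nonneg_right (error_factor_le hD') (by positivity))) (pow_pos hF 2)
    fun Z hZ => ?_).trans (le_of_eq ?_)
  · rw [Set.mem_ofPred_eq, trace_sampleCov (by lia)] at hZ
    rw [← sq_abs (blockEstimator _ _ _ - _)]
    exact pow_le_pow_left₀ hF.le hZ.le 2
  · field_simp
    norm_num

/-- Summing the entrywise errors bounds the mean squared Frobenius error by `(4/m)(tr² + 2 ‖S‖_F²)`,
`m = D.card`. Since `tr² ≤ p ‖S‖_F²`, this is of relative size `p / m`. -/
theorem measureReal_frobNorm_sampleCov (hS : S.PosSemidef) (hF : 0 < frobNorm S) (hp : 1 ≤ p)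
    (hD : 5 ≤ D.card) :
    (noiseLaw n S).real {Z | frobNorm S / 2 < |frobNorm (sampleCov D Z) - frobNorm S|} ≤
      48 * p / D.card := by
  have hD' : (5 : ℝ) ≤ D.card := by exact_mod_cast hD
  have hp' : (1 : ℝ) ≤ p := by exact_mod_cast hp
  have h := fun i j : Fin p =>
    blockEstimator_sq_error (n := n) hS (memLp_two_apply_mul i j) (D := D) (by lia)
  simp_rw [integral_apply_mul hS] at h
  have hint : Integrable (fun Z : Columns p n => frobNorm (sampleCov D Z - S) ^ 2)
      (noiseLaw n S) := by
    simp_rw [frobNorm_sq, Matrix.sub_apply, sampleCov_apply (D := D) (by lia)]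
    exact integrable_finsetSum _ fun i _ => integrable_finsetSum _ fun j _ => (h i j).1
  have hle : ∫ Z : Columns p n, frobNorm (sampleCov D Z - S) ^ 2 ∂(noiseLaw n S) ≤
      4 / D.card * (3 * p * frobNorm S ^ 2) := by
    simp_rw [frobNorm_sq (_ - S), Matrix.sub_apply, sampleCov_apply (D := D) (by lia)]
    rw [integral_finsetSum _ fun i _ => integrable_finsetSum _ fun j _ => (h i j).1,
      Finset.sum_congr rfl fun i _ => integral_finsetSum _ fun j _ => (h i j).1]
    calc _ ≤ ∑ i, ∑ j, 4 / (D.card : ℝ) *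
          ∫ x : EuclideanSpace ℝ (Fin p), (x i * x j) ^ 2 ∂(multivariateGaussian 0 S) := by
          refine Finset.sum_le_sum fun i _ => Finset.sum_le_sum fun j _ => (h i j).2.trans ?_
          exact mul_le_mul (error_factor_le hD') (variance_le_expectation_sq (by fun_prop))
            (variance_nonneg _ _) (by positivity)
      _ = 4 / D.card * (S.trace ^ 2 + 2 * frobNorm S ^ 2) := by
          rw [← sum_integral_apply_mul_sq hS]
          simp_rw [Finset.mul_sum]
      _ ≤ _ := by
          refine mul_le_mul_of_nonneg_left ?_ (by positivity)
          have := trace_sq_le S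
          nlinarith [sq_nonneg (frobNorm S)]
  refine (measureReal_le_of_integral_le hint (fun _ => sq_nonneg _) hle
    (c := (frobNorm S / 2) ^ 2) (by positivity) fun Z hZ => ?_).trans (le_of_eq ?_)
  · rw [Set.mem_ofPred_eq] at hZ
    exact pow_le_pow_left₀ (by positivity) (hZ.le.trans (abs_frobNorm_sub_le _ _)) 2
  · field_simp
    norm_num

/-- Only the direction of the top eigenvector of `S` is tested, so Chebyshev for one quadratic form
suffices and no dimension factor appears. -/
theorem measureReal_opNorm_sampleCov_lt (hS : S.PosSemidef) (hO : 0 < opNorm S) (hp : 1 ≤ p)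
    (hD : 5 ≤ D.card) :
    (noiseLaw n S).real {Z | opNorm (sampleCov D Z) < opNorm S / 2} ≤ 32 / D.card := by
  have hD' : (5 : ℝ) ≤ D.card := by exact_mod_cast hD
  obtain ⟨v, hv1, hv2, -⟩ := exists_top_eigenvector hS hp
  have h := blockEstimator_sq_error (n := n) hS (memLp_two_inner_sq v) (D := D) (by lia)
  rw [integral_inner_sq hS, variance_inner_sq hS, hv2] at h
  refine (measureReal_le_of_integral_le h.1 (fun _ => sq_nonneg _) (h.2.trans
    (mul_le_mul_of_nonneg_right (error_factor_le hD') (by positivity)))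
    (c := (opNorm S / 2) ^ 2) (by positivity) fun Z hZ => ?_).trans (le_of_eq ?_)
  · have h1 := quadForm_le (sampleCov D Z) v
    rw [quadForm_sampleCov (by lia), hv1] at h1
    rw [Set.mem_ofPred_eq] at hZ
    rw [← neg_sq (blockEstimator _ _ _ - _)]
    exact pow_le_pow_left₀ (by positivity) (by linarith) 2
  · field_simp
    norm_num

/-- Each column contributes an exponent `x + 2x²` with `x ≤ 1/4`, hence at most `3/8`. -/
theorem lintegral_exp_sum_inner_sq_le (hS : S.PosSemidef) (hO : 0 < opNorm S)
    {u : EuclideanSpace ℝ (Fin p)} (hu : ‖u‖ ≤ 1) :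
    ∫⁻ Z, ENNReal.ofReal (Real.exp (1 / (4 * opNorm S) * ∑ t ∈ D, ⟪u, Z t⟫ ^ 2))
      ∂(noiseLaw n S) ≤ ENNReal.ofReal (Real.exp (3 / 8 * D.card)) := by
  set s := 1 / (4 * opNorm S)
  have hs : 0 ≤ s := by positivity
  have hsq0 : 0 ≤ s * quadForm S u := mul_nonneg hs (quadForm_nonneg hS u)
  have hsq : s * quadForm S u ≤ 1 / 4 := by
    have h1 := quadForm_le S u
    have h2 : ‖u‖ ^ 2 ≤ 1 := pow_le_one₀ (norm_nonneg u) hu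
    calc s * quadForm S u ≤ s * opNorm S :=
          mul_le_mul_of_nonneg_left (h1.trans (mul_le_of_le_one_right hO.le h2)) hs
      _ = 1 / 4 := by simp only [s]; field_simp
  have h1 : ∀ Z : Columns p n, ENNReal.ofReal (Real.exp (s * ∑ t ∈ D, ⟪u, Z t⟫ ^ 2)) =
      ∏ t, if t ∈ D then ENNReal.ofReal (Real.exp (s * ⟪u, Z t⟫ ^ 2)) else 1 := by
    intro Z
    rw [Finset.prod_ite_mem, Finset.univ_inter, Finset.mul_sum, Real.exp_sum,
      ENNReal.ofReal_prod_of_nonneg fun i _ => (Real.exp_pos _).le]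
  simp_rw [h1]
  have h2 := lintegral_pi_prod (fun _ : Fin n => multivariateGaussian 0 S)
    (fun t x => if t ∈ D then ENNReal.ofReal (Real.exp (s * ⟪u, x⟫ ^ 2)) else 1)
    (fun t => by split_ifs <;> fun_prop)
  rw [h2]
  calc _ ≤ ∏ t : Fin n, if t ∈ D then ENNReal.ofReal (Real.exp (3 / 8)) else 1 := by
        refine Finset.prod_le_prod' fun t _ => ?_
        split_ifs
        · refine (lintegral_exp_inner_sq_le hS u hs hsq).trans (ENNReal.ofReal_le_ofReal
            (Real.exp_le_exp.2 ?_))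
          nlinarith
        · simp
    _ = _ := by
        rw [Finset.prod_ite_mem, Finset.univ_inter, Finset.prod_const,
          ← ENNReal.ofReal_pow (Real.exp_pos _).le, ← Real.exp_nat_mul, mul_comm]

/-- Integration over the unit ball replaces a union bound over a net. A large operator norm makes
the exponential of the quadratic form large on a whole ball of radius `1/4` near the top
eigenvector, a fraction `4^(-p)` of the volume. Markov's inequality for the integral over directions
then gives the bound. -/
theorem measureReal_lt_opNorm_sampleCov (hS : S.PosSemidef) (hO : 0 < opNorm S) (hp : 1 ≤ p)
    (hD : 5 ≤ D.card) :
    (noiseLaw n S).real {Z | 10 * opNorm S < opNorm (sampleCov D Z)} ≤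
      4 ^ p * Real.exp (-(D.card / 8)) := by
  have hD' : (5 : ℝ) ≤ D.card := by exact_mod_cast hD
  set m : ℝ := (D.card : ℝ)
  set s := 1 / (4 * opNorm S)
  have hs : 0 ≤ s := by positivity
  set E := EuclideanSpace ℝ (Fin p)
  set B := Metric.ball (0 : E) 1
  have hB0 : volume B ≠ 0 := (Metric.measure_ball_pos _ _ one_pos).ne'
  have hBt : volume B ≠ ⊤ := measure_ball_lt_top.ne
  set g : E → Columns p n → ℝ≥0∞ := fun u Z =>
    ENNReal.ofReal (Real.exp (s * ∑ t ∈ D, ⟪u, Z t⟫ ^ 2)) with hg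
  have hgm : Measurable (Function.uncurry g) := by
    simp only [hg, Function.uncurry_def]
    fun_prop
  have hupper : ∫⁻ Z, (∫⁻ u in B, g u Z) ∂(noiseLaw n S) ≤
      ENNReal.ofReal (Real.exp (3 / 8 * m)) * volume B := by
    rw [lintegral_lintegral_swap (f := fun Z u => g u Z) (hgm.comp measurable_swap).aemeasurable]
    refine (setLIntegral_mono' measurableSet_ball fun u hu =>
      lintegral_exp_sum_inner_sq_le hS hO (mem_ball_zero_iff.1 hu).le).trans ?_
    rw [setLIntegral_const]
  have hlower : ∀ Z : Columns p n, 10 * opNorm S < opNorm (sampleCov D Z) →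
      ENNReal.ofReal (Real.exp (m / 2) * (1 / 4) ^ p) * volume B ≤ ∫⁻ u in B, g u Z := by
    intro Z hZ
    obtain ⟨v, hv1, -, hv⟩ := exists_top_eigenvector (posSemidef_sampleCov (D := D) (by lia) Z) hp
    -- With centre `3v/4` the small ball stays inside the unit ball and `⟪v, u⟫ ≥ 1/2` holds
    -- throughout it.
    have hsub : Metric.ball ((3 / 4 : ℝ) • v) (1 / 4) ⊆ B := by
      refine Metric.ball_subset_ball' ?_
      rw [dist_zero_right, norm_smul, hv1]
      norm_num
    have hvol : volume (Metric.ball ((3 / 4 : ℝ) • v) (1 / 4)) =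
        ENNReal.ofReal ((1 / 4) ^ p) * volume B := by
      rw [Measure.addHaar_ball_of_pos _ _ (by norm_num), finrank_euclideanSpace, Fintype.card_fin]
    calc _ = ENNReal.ofReal (Real.exp (m / 2)) * volume (Metric.ball ((3 / 4 : ℝ) • v) (1 / 4)) := by
          rw [hvol, ENNReal.ofReal_mul (Real.exp_pos _).le, mul_assoc]
      _ = ∫⁻ u in Metric.ball ((3 / 4 : ℝ) • v) (1 / 4), ENNReal.ofReal (Real.exp (m / 2)) := by
          rw [setLIntegral_const]
      _ ≤ ∫⁻ u in Metric.ball ((3 / 4 : ℝ) • v) (1 / 4), g u Z := by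
          refine setLIntegral_mono' measurableSet_ball fun u hu => ?_
          refine ENNReal.ofReal_le_ofReal (Real.exp_le_exp.2 ?_)
          have h1 : 1 / 2 ≤ ⟪v, u⟫ := by
            have h2 := abs_real_inner_le_norm v (u - (3 / 4 : ℝ) • v)
            rw [hv1, one_mul, inner_sub_right, inner_smul_right, real_inner_self_eq_norm_sq,
              hv1] at h2
            rw [Metric.mem_ball, dist_eq_norm] at hu
            have := (abs_le.1 h2).1
            linarith
          have h3 : 10 * opNorm S * (1 / 4) ≤ quadForm (sampleCov D Z) u := by
            refine le_trans ?_ (hv u)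
            exact mul_le_mul hZ.le (by nlinarith) (by norm_num) (opNorm_nonneg _)
          have h4 := quadForm_sampleCov_le (D := D) (by lia) Z u
          have h5 : (m - 1) * (10 * opNorm S * (1 / 4)) ≤ ∑ t ∈ D, ⟪u, Z t⟫ ^ 2 :=
            (mul_le_mul_of_nonneg_left h3 (by linarith)).trans h4
          refine le_trans ?_ (mul_le_mul_of_nonneg_left h5 hs)
          -- The factor `10` is chosen so that this is at least `m/2` for `m ≥ 5`, which exceeds the
          -- exponent `3m/8` of the mean by `m/8`.
          have h6 : s * ((m - 1) * (10 * opNorm S * (1 / 4))) = 10 / 16 * (m - 1) := by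
            simp only [s]
            field_simp
            ring
          rw [h6]
          linarith
      _ ≤ _ := lintegral_mono_set hsub
  set c := ENNReal.ofReal (Real.exp (m / 2) * (1 / 4) ^ p) * volume B
  have hc0 : c ≠ 0 := mul_ne_zero (by simp only [ne_eq, ENNReal.ofReal_eq_zero, not_le]; positivity) hB0
  have hct : c ≠ ⊤ := ENNReal.mul_ne_top ENNReal.ofReal_ne_top hBt
  have hmark : noiseLaw n S {Z | 10 * opNorm S < opNorm (sampleCov D Z)} ≤
      ENNReal.ofReal (Real.exp (3 / 8 * m)) * volume B / c := by
    refine (measure_mono fun Z hZ => ?_).trans ((meas_ge_le_lintegral_div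
      (f := fun Z => ∫⁻ u in B, g u Z) ?_ hc0 hct).trans (ENNReal.div_le_div_right hupper _))
    · exact hlower Z hZ
    · exact hgm.lintegral_prod_left'.aemeasurable
  rw [ENNReal.mul_div_mul_right _ _ hB0 hBt, ← ENNReal.ofReal_div_of_pos (by positivity)] at hmark
  refine (ENNReal.toReal_le_of_le_ofReal (by positivity) hmark).trans (le_of_eq ?_)
  rw [div_mul_eq_div_div, ← Real.exp_sub, div_eq_mul_inv, mul_comm, one_div, inv_pow, inv_inv]
  congr 2
  ring

end Changepoint

namespace Changepoint

open scoped NNReal ENNReal RealInnerProductSpace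

variable {p n : ℕ} {S : Matrix (Fin p) (Fin p) ℝ}

/-! ### Measurability of the test. -/

section Measurability

theorem continuous_sampleCov (D : Finset (Fin n)) :
    Continuous (sampleCov D : Columns p n → Matrix (Fin p) (Fin p) ℝ) := by
  unfold sampleCov blockMean
  have h : Continuous fun X : Columns p n => ∑ t ∈ D,
      Matrix.vecMulVec (X t - (D.card : ℝ)⁻¹ • ∑ t ∈ D, X t).ofLp
        (X t - (D.card : ℝ)⁻¹ • ∑ t ∈ D, X t).ofLp :=
    continuous_finsetSum D fun t _ => Continuous.matrix_vecMulVec (by fun_prop) (by fun_prop)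
  exact h.const_smul ((D.card : ℝ) - 1)⁻¹

theorem continuous_opNorm :
    Continuous (opNorm : Matrix (Fin p) (Fin p) ℝ → ℝ) := by
  unfold opNorm
  exact (LinearMap.continuous_of_finiteDimensional
    (Matrix.toEuclideanCLM (n := Fin p) (𝕜 := ℝ)).toAlgEquiv.toLinearMap).norm

theorem continuous_frobNorm :
    Continuous (frobNorm : Matrix (Fin p) (Fin p) ℝ → ℝ) := by
  unfold frobNorm
  fun_prop

theorem continuous_median3 : Continuous median3 := by
  unfold median3
  fun_prop

theorem continuous_cusum (t : ℕ) :
    Continuous (cusum t : Columns p n → EuclideanSpace ℝ (Fin p)) := by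
  unfold cusum
  fun_prop

theorem measurable_psiCov (C : ℝ) : Measurable (psiCov C : Columns p n → ℝ) := by
  have hS := fun j : Fin 3 => continuous_sampleCov (p := p) (block n j)
  have h1 : Continuous (medTrace : Columns p n → ℝ) :=
    continuous_median3.comp (continuous_pi fun j => (hS j).matrix_trace)
  have h2 : Continuous (medFrob : Columns p n → ℝ) :=
    continuous_median3.comp (continuous_pi fun j => continuous_frobNorm.comp (hS j))
  have h3 : Continuous (medOp : Columns p n → ℝ) :=
    continuous_median3.comp (continuous_pi fun j => continuous_opNorm.comp (hS j))
  have h4 : Continuous (maxCusumSq : Columns p n → ℝ) :=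
    Continuous.finset_sup'_apply _ fun t _ => (continuous_cusum t).norm.pow 2
  refine measurable_const.indicator (measurableSet_lt ?_ ?_)
  · exact Continuous.measurable (by fun_prop)
  · exact (h4.sub h1).measurable

end Measurability

/-! ### Good estimates on blocks and medians of three. -/

section Blocks

theorem card_block (h3 : 3 ∣ n) (j : Fin 3) : (block n j).card = n / 3 := by
  have h : (block n j).map Fin.valEmbedding = Finset.Ico (j * (n / 3)) ((j + 1) * (n / 3)) := by
    ext i
    simp only [block, Finset.mem_map, Finset.mem_filter, Finset.mem_univ, true_and,
      Fin.valEmbedding_apply, Finset.mem_Ico]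
    constructor
    · rintro ⟨a, ha, rfl⟩
      exact ha
    · intro hi
      refine ⟨⟨i, hi.2.trans_le ?_⟩, hi, rfl⟩
      calc ((j : ℕ) + 1) * (n / 3) ≤ 3 * (n / 3) := Nat.mul_le_mul_right _ (by lia)
        _ = n := Nat.mul_div_cancel' h3
  rw [← Finset.card_map Fin.valEmbedding, h, Nat.card_Ico, ← Nat.sub_mul]
  simp

/-- The covariance functionals of `M` are comparable with those of `S`. -/
def IsGoodEstimate (S M : Matrix (Fin p) (Fin p) ℝ) : Prop :=
  |M.trace - S.trace| ≤ frobNorm S ∧ |frobNorm M - frobNorm S| ≤ frobNorm S / 2 ∧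
    opNorm S / 2 ≤ opNorm M ∧ opNorm M ≤ 10 * opNorm S

theorem measureReal_not_isGoodEstimate (hS : S.PosSemidef) (hF : 0 < frobNorm S)
    (hO : 0 < opNorm S) (hp : 1 ≤ p) {D : Finset (Fin n)} (hD : 48 * p ≤ D.card) :
    (noiseLaw n S).real {Z | ¬ IsGoodEstimate S (sampleCov D Z)} ≤ 100 * p / D.card := by
  have hD5 : 5 ≤ D.card := by lia
  have hD' : (48 : ℝ) * p ≤ D.card := by exact_mod_cast hD
  have hp' : (1 : ℝ) ≤ p := by exact_mod_cast hp
  set m : ℝ := (D.card : ℝ)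
  have hm : 0 < m := by linarith
  have h1 := measureReal_trace_sampleCov (n := n) hS hF hD5
  have h2 := measureReal_frobNorm_sampleCov (n := n) hS hF hp hD5
  have h3 := measureReal_opNorm_sampleCov_lt (n := n) hS hO hp hD5
  have h4 := measureReal_lt_opNorm_sampleCov (n := n) hS hO hp hD5
  -- Since `4 ≤ e²` and `2p ≤ m/24`, the exponent is at most `-m/12`; the exponential decay is then
  -- weakened to `12/m` to match the Chebyshev bounds.
  have h5 : (4 : ℝ) ^ p * Real.exp (-(m / 8)) ≤ 12 / m := by
    have h6 : (4 : ℝ) ≤ Real.exp 2 := by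
      have := Real.quadratic_le_exp_of_nonneg (x := 2) (by norm_num)
      linarith
    calc (4 : ℝ) ^ p * Real.exp (-(m / 8)) ≤ Real.exp 2 ^ p * Real.exp (-(m / 8)) := by gcongr
      _ = Real.exp (p * 2 + -(m / 8)) := by rw [← Real.exp_nat_mul, ← Real.exp_add]
      _ ≤ Real.exp (-(m / 12)) := Real.exp_le_exp.2 (by linarith)
      _ ≤ (m / 12)⁻¹ := by
          rw [Real.exp_neg]
          refine inv_anti₀ (by positivity) ?_
          linarith [Real.add_one_le_exp (m / 12)]
      _ = 12 / m := by rw [inv_div]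
  have hsub : {Z : Columns p n | ¬ IsGoodEstimate S (sampleCov D Z)} ⊆
      (({Z | frobNorm S < |(sampleCov D Z).trace - S.trace|} ∪
        {Z | frobNorm S / 2 < |frobNorm (sampleCov D Z) - frobNorm S|}) ∪
        {Z | opNorm (sampleCov D Z) < opNorm S / 2}) ∪
        {Z | 10 * opNorm S < opNorm (sampleCov D Z)} := by
    intro Z hZ
    by_contra hcon
    simp only [Set.mem_union, Set.mem_ofPred_eq, not_or, not_lt] at hcon
    exact hZ ⟨hcon.1.1.1, hcon.1.1.2, hcon.1.2, hcon.2⟩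
  refine (measureReal_mono hsub).trans ((measureReal_union_le _ _).trans ?_)
  have h6 := measureReal_union_le (μ := noiseLaw n S)
    ({Z | frobNorm S < |(sampleCov D Z).trace - S.trace|} ∪
        {Z | frobNorm S / 2 < |frobNorm (sampleCov D Z) - frobNorm S|})
    {Z | opNorm (sampleCov D Z) < opNorm S / 2}
  have h7 := measureReal_union_le (μ := noiseLaw n S)
    {Z | frobNorm S < |(sampleCov D Z).trace - S.trace|}
    {Z | frobNorm S / 2 < |frobNorm (sampleCov D Z) - frobNorm S|}
  have h8 : 8 / m + 48 * p / m + 32 / m + 12 / m ≤ 100 * p / m := by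
    rw [← add_div, ← add_div, ← add_div]
    gcongr
    linarith
  linarith

theorem median3_le {a : Fin 3 → ℝ} {b : ℝ} {j k : Fin 3} (hjk : j ≠ k) (hj : a j ≤ b)
    (hk : a k ≤ b) : median3 a ≤ b := by
  fin_cases j <;> fin_cases k <;> simp_all [median3]

theorem le_median3 {a : Fin 3 → ℝ} {b : ℝ} {j k : Fin 3} (hjk : j ≠ k) (hj : b ≤ a j)
    (hk : b ≤ a k) : b ≤ median3 a := by
  fin_cases j <;> fin_cases k <;> simp_all [median3]

/-- A bound satisfied by two of three numbers passes to their median, whatever the third block does.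
The three medians need not come from the same block. -/
theorem median_bounds {X : Columns p n} {j k : Fin 3} (hjk : j ≠ k)
    (hj : IsGoodEstimate S (sampleCov (block n j) X))
    (hk : IsGoodEstimate S (sampleCov (block n k) X)) :
    |medTrace X - S.trace| ≤ frobNorm S ∧ frobNorm S / 2 ≤ medFrob X ∧
      medFrob X ≤ 2 * frobNorm S ∧ opNorm S / 2 ≤ medOp X ∧ medOp X ≤ 10 * opNorm S := by
  obtain ⟨h1, h2, h3, h4⟩ := hj
  obtain ⟨k1, k2, k3, k4⟩ := hk
  have hF := frobNorm_nonneg S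
  rw [abs_le] at h1 h2 k1 k2
  refine ⟨abs_le.2 ⟨?_, ?_⟩, le_median3 hjk ?_ ?_, median3_le hjk ?_ ?_, le_median3 hjk h3 k3,
    median3_le hjk h4 k4⟩
  · have : S.trace - frobNorm S ≤ medTrace X := le_median3 hjk (by linarith) (by linarith)
    linarith
  · have : medTrace X ≤ S.trace + frobNorm S := median3_le hjk (by linarith) (by linarith)
    linarith
  all_goals linarith

end Blocks

/-! ### The statistics `Y_t` and the dyadic grid. -/

section Cusum

theorem card_filter_lt {t : ℕ} (ht : t ≤ n) :
    (Finset.univ.filter (fun i : Fin n => (i : ℕ) < t)).card = t := by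
  rw [Fin.card_filter_val_lt]
  exact min_eq_right ht

theorem card_filter_ge {t : ℕ} (ht : t ≤ n) :
    (Finset.univ.filter (fun i : Fin n => n - t ≤ (i : ℕ))).card = t := by
  have h := Finset.card_filter_add_card_filter_not (s := Finset.univ)
    (fun i : Fin n => (i : ℕ) < n - t)
  simp only [not_lt] at h
  rw [card_filter_lt (by lia), Finset.card_univ, Fintype.card_fin] at h
  lia

theorem cusum_add (t : ℕ) (θ Z : Columns p n) : cusum t (θ + Z) = cusum t θ + cusum t Z := by
  simp only [cusum, Pi.add_apply, Finset.sum_add_distrib]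
  rw [← smul_add]
  congr 1
  abel

theorem cusum_of_eq {t : ℕ} (ht : t ≤ n) {θ : Columns p n} {μ₁ μ₂ : EuclideanSpace ℝ (Fin p)}
    (h₁ : ∀ i : Fin n, (i : ℕ) < t → θ i = μ₁) (h₂ : ∀ i : Fin n, n - t ≤ (i : ℕ) → θ i = μ₂) :
    cusum t θ = ((Real.sqrt (2 * t))⁻¹ * t) • (μ₁ - μ₂) := by
  rw [cusum, Finset.sum_congr rfl fun i hi => h₁ i (Finset.mem_filter.1 hi).2,
    Finset.sum_congr rfl fun i hi => h₂ i (Finset.mem_filter.1 hi).2, Finset.sum_const,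
    Finset.sum_const, card_filter_lt ht, card_filter_ge ht, ← smul_sub, mul_smul,
    Nat.cast_smul_eq_nsmul]

/-- Because `2t ≤ n`, the first and last `t` columns are disjoint, so the `2t` weights `±1/√(2t)`
have squares summing to one. -/
theorem measurePreserving_cusum (hS : S.PosSemidef) {t : ℕ} (ht : 1 ≤ t) (htn : 2 * t ≤ n) :
    MeasurePreserving (cusum t) (noiseLaw n S) (multivariateGaussian 0 S) := by
  refine ⟨(continuous_cusum t).measurable, ?_⟩
  have ht' : (0 : ℝ) < 2 * t := by
    have : (1 : ℝ) ≤ t := by exact_mod_cast ht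
    linarith
  have h := map_sum_smul_noiseLaw (n := n) hS
    (fun i => (Real.sqrt (2 * t))⁻¹ * ((if (i : ℕ) < t then 1 else 0) -
      (if n - t ≤ (i : ℕ) then 1 else 0))) (by
      have e : ∀ i : Fin n, ((Real.sqrt (2 * t))⁻¹ * ((if (i : ℕ) < t then (1 : ℝ) else 0) -
          (if n - t ≤ (i : ℕ) then 1 else 0))) ^ 2 = (2 * t : ℝ)⁻¹ *
          ((if (i : ℕ) < t then (1 : ℝ) else 0) + (if n - t ≤ (i : ℕ) then 1 else 0)) := by
        intro i
        rw [mul_pow, inv_pow, Real.sq_sqrt ht'.le]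
        congr 1
        split_ifs with h1 h2
        · lia
        all_goals norm_num
      simp_rw [e]
      rw [← Finset.mul_sum, Finset.sum_add_distrib, Finset.sum_boole, Finset.sum_boole,
        card_filter_lt (by lia), card_filter_ge (by lia), ← two_mul]
      exact inv_mul_cancel₀ ht'.ne')
  rw [← h]
  congr 1
  ext1 Z
  simp_rw [mul_smul, sub_smul, ite_smul, one_smul, zero_smul]
  rw [← Finset.smul_sum, Finset.sum_sub_distrib, Finset.sum_ite, Finset.sum_ite]
  simp [cusum]

theorem mem_candidateTimes_iff {t : ℕ} :
    t ∈ candidateTimes n ↔ ∃ k ≤ ⌊Real.logb 2 ((n : ℝ) / 2)⌋₊, 2 ^ k = t := by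
  simp [candidateTimes]

theorem le_floor_logb_iff (hn : 2 ≤ n) (k : ℕ) :
    k ≤ ⌊Real.logb 2 ((n : ℝ) / 2)⌋₊ ↔ 2 * 2 ^ k ≤ n := by
  have hn' : (2 : ℝ) ≤ n := by exact_mod_cast hn
  rw [Nat.le_floor_iff (Real.logb_nonneg (by norm_num) (by linarith)),
    Real.le_logb_iff_rpow_le (by norm_num) (by linarith), Real.rpow_natCast,
    le_div_iff₀ (by norm_num), ← @Nat.cast_le ℝ]
  push_cast
  rw [mul_comm]

theorem candidateTimes_bounds (hn : 2 ≤ n) {t : ℕ} (ht : t ∈ candidateTimes n) :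
    1 ≤ t ∧ 2 * t ≤ n := by
  obtain ⟨k, hk, rfl⟩ := mem_candidateTimes_iff.1 ht
  exact ⟨Nat.one_le_two_pow, (le_floor_logb_iff hn k).1 hk⟩

theorem exists_mem_candidateTimes (hn : 2 ≤ n) {d : ℕ} (hd : 1 ≤ d) (hdn : 2 * d ≤ n) :
    ∃ t ∈ candidateTimes n, t ≤ d ∧ d < 2 * t := by
  refine ⟨2 ^ Nat.log 2 d, mem_candidateTimes_iff.2 ⟨Nat.log 2 d, ?_, rfl⟩, ?_, ?_⟩
  · rw [le_floor_logb_iff hn]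
    have := Nat.pow_log_le_self 2 (x := d) (by lia)
    lia
  · exact Nat.pow_log_le_self 2 (by lia)
  · have := Nat.lt_pow_succ_log_self (b := 2) (by norm_num) d
    rwa [pow_succ, mul_comm] at this

/-- The grid has at most `log₂ n` points and `1 / log 2 < 2`. The bound is stated as `2 exp (loglog8
n)` in disguise, ready for the union bound. -/
theorem card_candidateTimes_le (hn : 2 ≤ n) :
    ((candidateTimes n).card : ℝ) ≤ 2 * Real.log (8 * n) := by
  have hn' : (2 : ℝ) ≤ n := by exact_mod_cast hn
  have h1 : (candidateTimes n).card ≤ ⌊Real.logb 2 ((n : ℝ) / 2)⌋₊ + 1 := by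
    have h := Finset.card_image_le (s := Finset.range (⌊Real.logb 2 ((n : ℝ) / 2)⌋₊ + 1))
      (f := fun k => 2 ^ k)
    rwa [Finset.card_range] at h
  have h2 : (⌊Real.logb 2 ((n : ℝ) / 2)⌋₊ : ℝ) ≤ Real.logb 2 ((n : ℝ) / 2) :=
    Nat.floor_le (Real.logb_nonneg (by norm_num) (by linarith))
  have h3 : ((candidateTimes n).card : ℝ) ≤ Real.logb 2 ((n : ℝ) / 2) + 1 := by
    have : ((candidateTimes n).card : ℝ) ≤ ⌊Real.logb 2 ((n : ℝ) / 2)⌋₊ + 1 := by exact_mod_cast h1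
    linarith
  have h4 : Real.logb 2 ((n : ℝ) / 2) + 1 = Real.log n / Real.log 2 := by
    rw [Real.logb_div (by linarith) (by norm_num), Real.logb_self_eq_one (by norm_num),
      sub_add_cancel, Real.logb]
  rw [h4] at h3
  refine h3.trans ?_
  have h5 := Real.log_two_gt_d9
  have h6 : 0 ≤ Real.log n := Real.log_nonneg (by linarith)
  have h7 : Real.log n ≤ Real.log (8 * n) := Real.log_le_log (by linarith) (by linarith)
  rw [div_le_iff₀ (by linarith)]
  nlinarith

/-- Here `8n ≥ 48 > e³` and `3 > e`. Consequently both matrix norms are absorbed into `rate`. -/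
theorem one_le_loglog8 (hn : 6 ≤ n) : 1 ≤ loglog8 n := by
  have hn' : (6 : ℝ) ≤ n := by exact_mod_cast hn
  have h1 : Real.exp 3 ≤ 8 * n := by
    have := Real.exp_one_lt_d9
    have h2 : Real.exp 3 = Real.exp 1 ^ 3 := by rw [← Real.exp_nat_mul]; norm_num
    have h3 : Real.exp 1 ^ 3 ≤ 2.7182818286 ^ 3 :=
      pow_le_pow_left₀ (Real.exp_pos _).le this.le 3
    rw [h2]
    norm_num at h3 ⊢
    linarith
  have h2 : 3 ≤ Real.log (8 * n) := (Real.le_log_iff_exp_le (by linarith)).2 h1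
  rw [loglog8, Real.le_log_iff_exp_le (by linarith)]
  have := Real.exp_one_lt_d9
  linarith

theorem exp_loglog8 (hn : 6 ≤ n) : Real.exp (loglog8 n) = Real.log (8 * n) := by
  have hn' : (6 : ℝ) ≤ n := by exact_mod_cast hn
  exact Real.exp_log (Real.log_pos (by linarith))

end Cusum

end Changepoint

/-! ### The two error probabilities of the test. -/

namespace Changepoint

open scoped NNReal ENNReal RealInnerProductSpace

variable {p n : ℕ} {S : Matrix (Fin p) (Fin p) ℝ}

/-- The separation rate of the testing problem, up to constants. -/
noncomputable def rate (n : ℕ) (S : Matrix (Fin p) (Fin p) ℝ) : ℝ :=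
  max (frobNorm S * Real.sqrt (loglog8 n)) (opNorm S * loglog8 n)

/-- The rejection region of the test. -/
def rejectionRegion (p n : ℕ) (C : ℝ) : Set (Columns p n) :=
  {X | C * max (medFrob X * Real.sqrt (loglog8 n)) (medOp X * loglog8 n)
      < maxCusumSq X - medTrace X}

theorem measurableSet_rejectionRegion (C : ℝ) : MeasurableSet (rejectionRegion p n C) := by
  have h : rejectionRegion p n C = psiCov C ⁻¹' {1} := by
    ext X
    simp [psiCov, rejectionRegion, Set.indicator_apply, lt_sub_iff_add_lt]
  rw [h]
  exact measurable_psiCov C (measurableSet_singleton 1)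

theorem integral_psiCov (C : ℝ) (θ : Columns p n) :
    ∫ X, psiCov C X ∂(dataLaw S θ) =
      (noiseLaw n S).real {Z | θ + Z ∈ rejectionRegion p n C} := by
  have h : (psiCov C : Columns p n → ℝ) = (rejectionRegion p n C).indicator 1 := rfl
  rw [h, integral_indicator_one (measurableSet_rejectionRegion C), dataLaw_eq_map,
    map_measureReal_apply (by fun_prop) (measurableSet_rejectionRegion C)]
  rfl

theorem integral_one_sub_psiCov (C : ℝ) (θ : Columns p n) :
    ∫ X, (1 - psiCov C X) ∂(dataLaw S θ) =
      (noiseLaw n S).real {Z | θ + Z ∉ rejectionRegion p n C} := by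
  have h : (fun X : Columns p n => 1 - psiCov C X) = ((rejectionRegion p n C)ᶜ).indicator 1 := by
    ext X
    by_cases hX : X ∈ rejectionRegion p n C
    · have : psiCov C X = 1 := Set.indicator_of_mem hX _
      simp [this, hX]
    · have : psiCov C X = 0 := Set.indicator_of_notMem hX _
      simp [this, hX]
  rw [h, integral_indicator_one (measurableSet_rejectionRegion C).compl, dataLaw_eq_map,
    map_measureReal_apply (by fun_prop) (measurableSet_rejectionRegion C).compl]
  rfl

theorem opNorm_pos (hS : S.PosDef) (hp : 1 ≤ p) : 0 < opNorm S := by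
  have h1 := quadForm_le S (EuclideanSpace.single (⟨0, hp⟩ : Fin p) 1)
  rw [← integral_inner_sq hS.posSemidef] at h1
  simp only [EuclideanSpace.inner_single_left, map_one, one_mul, PiLp.norm_single,
    norm_one, one_pow, mul_one] at h1
  simp_rw [sq] at h1
  rw [integral_apply_mul hS.posSemidef] at h1
  exact hS.diag_pos.trans_le h1

theorem frobNorm_le_rate (hn : 6 ≤ n) : frobNorm S ≤ rate n S :=
  le_trans (le_mul_of_one_le_right (frobNorm_nonneg S) (Real.one_le_sqrt.2 (one_le_loglog8 hn)))
    (le_max_left _ _)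

theorem opNorm_le_rate (hn : 6 ≤ n) : opNorm S ≤ rate n S :=
  (opNorm_le_frobNorm S).trans (frobNorm_le_rate hn)

/-- The noise of some block has atypical covariance functionals. -/
def badNoise (n : ℕ) (S : Matrix (Fin p) (Fin p) ℝ) : Set (Columns p n) :=
  ⋃ j : Fin 3, {Z | ¬ IsGoodEstimate S (sampleCov (block n j) Z)}

theorem measureReal_badNoise_le (hS : S.PosDef) (hp : 1 ≤ p) (h3 : 3 ∣ n) {c : ℝ}
    (hc : c ≤ 1 / 144) (hpn : (p : ℝ) ≤ c * n) :
    (noiseLaw n S).real (badNoise n S) ≤ 900 * c := by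
  have hp' : (1 : ℝ) ≤ p := by exact_mod_cast hp
  have hO := opNorm_pos hS hp
  have hF : 0 < frobNorm S := hO.trans_le (opNorm_le_frobNorm S)
  have hm : ((n / 3 : ℕ) : ℝ) = n / 3 := by
    rw [Nat.cast_div h3 (by norm_num)]
    norm_num
  have hn0 : (0 : ℝ) ≤ n := Nat.cast_nonneg n
  -- This is the role of `1/144`. Each block then fails with probability at most `100p / (n/3) ≤
  -- 300c`.
  have hcard : 48 * p ≤ n / 3 := by
    rw [← @Nat.cast_le ℝ]
    push_cast [hm]
    nlinarith
  have hn : (0 : ℝ) < n := by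
    rcases hn0.eq_or_lt with h | h
    · rw [← h] at hpn
      linarith
    · exact h
  have hj : ∀ j : Fin 3, (noiseLaw n S).real
      {Z | ¬ IsGoodEstimate S (sampleCov (block n j) Z)} ≤ 300 * c := by
    intro j
    refine (measureReal_not_isGoodEstimate hS.posSemidef hF hO hp
      (by rwa [card_block h3])).trans ?_
    rw [card_block h3, hm, div_le_iff₀ (by positivity)]
    linarith
  refine (measureReal_iUnion_fintype_le _).trans ((Finset.sum_le_sum fun j _ => hj j).trans ?_)
  simp
  linarith

theorem isGoodEstimate_add (h3 : 3 ∣ n) (hn : 6 ≤ n) {θ Z : Columns p n} (hZ : Z ∉ badNoise n S)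
    {j : Fin 3} {μ : EuclideanSpace ℝ (Fin p)} (hθ : ∀ t ∈ block n j, θ t = μ) :
    IsGoodEstimate S (sampleCov (block n j) (θ + Z)) := by
  rw [sampleCov_add_of_const (by rw [card_block h3]; lia) hθ]
  simp only [badNoise, Set.mem_iUnion, not_exists] at hZ
  exact not_not.1 (hZ j)

/-- For good noise the threshold is at least `C R / 2` with `R = rate n S`, and the trace error
costs at most `R`. A rejection thus forces some `‖Y_t‖²` above `tr S + (C/2 - 1) R`, and a union
bound over the grid applies. -/
theorem null_rejection_le (hS : S.PosDef) (hp : 1 ≤ p) (hn : 6 ≤ n) (h3 : 3 ∣ n) {c C : ℝ}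
    (hc : c ≤ 1 / 144) (hpn : (p : ℝ) ≤ c * n) (hC : 11 < C) {θ : Columns p n}
    (hθ : θ ∈ nullSpace p n) :
    (noiseLaw n S).real {Z | θ + Z ∈ rejectionRegion p n C} ≤ 900 * c + 16 / (C - 11) := by
  obtain ⟨μ, hμ⟩ := hθ
  have hO := opNorm_pos hS hp
  have hF : 0 < frobNorm S := hO.trans_le (opNorm_le_frobNorm S)
  have hL := one_le_loglog8 hn
  set L := loglog8 n
  set A : ℕ → Set (Columns p n) := fun t =>
    cusum t ⁻¹' {x | S.trace + (C / 2 - 1) * rate n S ≤ ‖x‖ ^ 2} with hA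
  have hsub : {Z | θ + Z ∈ rejectionRegion p n C} ⊆
      badNoise n S ∪ ⋃ t ∈ candidateTimes n, A t := by
    intro Z hZ
    by_contra hcon
    rw [Set.mem_union, not_or] at hcon
    obtain ⟨hb, hY⟩ := hcon
    obtain ⟨h1, h2, -, h4, -⟩ := median_bounds (j := 0) (k := 1) (by decide)
      (isGoodEstimate_add h3 hn hb fun t _ => hμ t) (isGoodEstimate_add h3 hn hb fun t _ => hμ t)
    rw [Set.mem_ofPred_eq, rejectionRegion, Set.mem_ofPred_eq] at hZ
    obtain ⟨t, ht, hmax⟩ := Finset.exists_mem_eq_sup' (candidateTimes_nonempty n)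
      fun t => ‖cusum t (θ + Z)‖ ^ 2
    obtain ⟨ht1, ht2⟩ := candidateTimes_bounds (by lia) ht
    have h0 : cusum t θ = 0 := by
      rw [cusum_of_eq (by lia) (fun i _ => hμ i) (fun i _ => hμ i), sub_self, smul_zero]
    rw [maxCusumSq, hmax, cusum_add, h0, zero_add] at hZ
    simp only [Set.mem_iUnion, not_exists] at hY
    refine hY t ht ?_
    simp only [hA, Set.mem_preimage, Set.mem_ofPred_eq]
    have h5 : rate n S / 2 ≤ max (medFrob (θ + Z) * Real.sqrt L) (medOp (θ + Z) * L) := by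
      have hs := Real.sqrt_nonneg L
      rw [div_le_iff₀ (by norm_num)]
      refine max_le ?_ ?_
      · have := le_max_left (medFrob (θ + Z) * Real.sqrt L) (medOp (θ + Z) * L)
        nlinarith
      · have := le_max_right (medFrob (θ + Z) * Real.sqrt L) (medOp (θ + Z) * L)
        nlinarith
    have h6 := mul_le_mul_of_nonneg_left h5 (by linarith : (0 : ℝ) ≤ C)
    have h7 := frobNorm_le_rate (S := S) hn
    rw [abs_le] at h1
    linarith
  have hAt : ∀ t ∈ candidateTimes n, (noiseLaw n S).real (A t) ≤
      Real.exp (L / 8 - (C / 2 - 1) * (L / 4)) := by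
    intro t ht
    obtain ⟨ht1, ht2⟩ := candidateTimes_bounds (by lia) ht
    have hmp := measurePreserving_cusum (n := n) hS.posSemidef ht1 ht2
    rw [hA, hmp.measureReal_preimage
      (measurableSet_le measurable_const (by fun_prop)).nullMeasurableSet]
    exact measureReal_norm_sq_ge_le hS.posSemidef hF hO (by linarith) (by linarith)
  have hsum : (noiseLaw n S).real (⋃ t ∈ candidateTimes n, A t) ≤ 16 / (C - 11) := by
    calc _ ≤ ∑ t ∈ candidateTimes n, (noiseLaw n S).real (A t) :=
          measureReal_biUnion_finset_le _ _
      _ ≤ (candidateTimes n).card * Real.exp (L / 8 - (C / 2 - 1) * (L / 4)) := by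
          rw [← nsmul_eq_mul]
          exact Finset.sum_le_card_nsmul _ _ _ hAt
      _ ≤ (2 * Real.exp L) * Real.exp (L / 8 - (C / 2 - 1) * (L / 4)) := by
          refine mul_le_mul_of_nonneg_right ?_ (Real.exp_pos _).le
          rw [exp_loglog8 hn]
          exact card_candidateTimes_le (by lia)
      -- The constant `11` collects `L` from the grid size, `L/8` from the Chernoff bound and `L/4`
      -- from the trace error.
      _ = 2 * Real.exp (-(L * ((C - 11) / 8))) := by
          rw [mul_assoc, ← Real.exp_add]
          congr 2
          ring
      _ ≤ 2 * Real.exp (-((C - 11) / 8)) := by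
          refine mul_le_mul_of_nonneg_left (Real.exp_le_exp.2 (neg_le_neg ?_)) (by norm_num)
          exact le_mul_of_one_le_left (by linarith) hL
      _ ≤ 2 * ((C - 11) / 8)⁻¹ := by
          rw [Real.exp_neg]
          refine mul_le_mul_of_nonneg_left (inv_anti₀ (by linarith) ?_) (by norm_num)
          linarith [Real.add_one_le_exp ((C - 11) / 8)]
      _ = 16 / (C - 11) := by
          rw [inv_div]
          ring
  have hbad := measureReal_badNoise_le hS hp h3 hc hpn
  have := (measureReal_mono hsub (μ := noiseLaw n S)).trans (measureReal_union_le _ _)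
  linarith

/-- A change can fall strictly inside at most one block; comparing `t₀` with the two interior block
boundaries identifies two unaffected ones. -/
theorem exists_two_const_blocks {t₀ : ℕ} {θ : Columns p n}
    {μ₁ μ₂ : EuclideanSpace ℝ (Fin p)} (h₁ : ∀ i : Fin n, (i : ℕ) < t₀ → θ i = μ₁)
    (h₂ : ∀ i : Fin n, t₀ ≤ (i : ℕ) → θ i = μ₂) :
    ∃ j k : Fin 3, j ≠ k ∧ (∃ μ, ∀ t ∈ block n j, θ t = μ) ∧ ∃ μ, ∀ t ∈ block n k, θ t = μ := by
  have hleft : ∀ j : Fin 3, ((j : ℕ) + 1) * (n / 3) ≤ t₀ → ∃ μ, ∀ t ∈ block n j, θ t = μ :=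
    fun j hj => ⟨μ₁, fun t ht => h₁ t ((Finset.mem_filter.1 ht).2.2.trans_le hj)⟩
  have hright : ∀ j : Fin 3, t₀ ≤ (j : ℕ) * (n / 3) → ∃ μ, ∀ t ∈ block n j, θ t = μ :=
    fun j hj => ⟨μ₂, fun t ht => h₂ t (hj.trans (Finset.mem_filter.1 ht).2.1)⟩
  rcases le_total t₀ (1 * (n / 3)) with h | h
  · refine ⟨1, 2, by decide, hright 1 (by simpa using h), hright 2 ?_⟩
    exact h.trans (Nat.mul_le_mul_right _ (by norm_num))
  rcases le_total t₀ (2 * (n / 3)) with h' | h'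
  · exact ⟨0, 2, by decide, hleft 0 (by simpa using h), hright 2 (by simpa using h')⟩
  · exact ⟨0, 1, by decide, hleft 0 (by simpa using h), hleft 1 (by simpa using h')⟩

/-- Take the largest power of two `t ≤ d = min t₀ (n - t₀)`. Both windows lie on their own side of
the change, so the mean of `Y_t` has squared norm `(t/2) ‖μ₁ - μ₂‖²`, while `t₀ (n - t₀) / n ≤ d <
2t`. Rounding to the grid thus costs only a constant factor. -/
theorem exists_cusum_signal (hn : 2 ≤ n) {s : ℕ} {ρ : ℝ} {θ : Columns p n}
    (hθ : θ ∈ altSpace p n s ρ) :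
    ∃ t ∈ candidateTimes n, ρ ^ 2 ≤ 4 * ‖cusum t θ‖ ^ 2 := by
  obtain ⟨t₀, ht1, htn, μ₁, μ₂, h₁, h₂, -, hρ⟩ := hθ
  obtain ⟨t, ht, htd, hdt⟩ := exists_mem_candidateTimes hn (d := min t₀ (n - t₀)) (by lia) (by lia)
  refine ⟨t, ht, ?_⟩
  have ht0 := (candidateTimes_bounds hn ht).1
  have ht0' : (0 : ℝ) < t := by exact_mod_cast ht0
  rw [cusum_of_eq (by lia) (fun i hi => h₁ i (by lia)) (fun i hi => h₂ i (by lia)), norm_smul,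
    mul_pow, Real.norm_eq_abs, sq_abs, mul_pow, inv_pow, Real.sq_sqrt (by positivity)]
  refine hρ.trans ?_
  have hfac : (t₀ : ℝ) * ((n : ℝ) - t₀) / n ≤ 2 * t := by
    have hn' : (0 : ℝ) < n := by exact_mod_cast (by lia : 0 < n)
    rw [div_le_iff₀ hn']
    have e : ((n - t₀ : ℕ) : ℝ) = (n : ℝ) - t₀ := Nat.cast_sub htn.le
    have ht₀ : (0 : ℝ) ≤ t₀ := Nat.cast_nonneg _
    have ht₀n : (0 : ℝ) ≤ (n : ℝ) - t₀ := e ▸ Nat.cast_nonneg _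
    rcases le_total t₀ (n - t₀) with h | h
    · rw [min_eq_left h] at hdt
      have : (t₀ : ℝ) ≤ 2 * t := by exact_mod_cast hdt.le
      exact mul_le_mul this (by linarith) ht₀n (by linarith)
    · rw [min_eq_right h] at hdt
      have : ((n - t₀ : ℕ) : ℝ) ≤ 2 * t := by exact_mod_cast hdt.le
      rw [e] at this
      rw [mul_comm]
      exact mul_le_mul this (by linarith) ht₀ (by linarith)
  calc _ ≤ 2 * (t : ℝ) * ‖μ₁ - μ₂‖ ^ 2 := mul_le_mul_of_nonneg_right hfac (sq_nonneg _)
    _ = _ := by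
        field_simp
        ring

theorem measureReal_abs_norm_sq_sub_trace_ge (hS : S.PosSemidef) (hF : 0 < frobNorm S) {K : ℝ}
    (hK : 0 < K) :
    (multivariateGaussian 0 S).real {x | K * frobNorm S ≤ |‖x‖ ^ 2 - S.trace|} ≤ 2 / K ^ 2 := by
  have hm : MemLp (fun x : EuclideanSpace ℝ (Fin p) => ‖x‖ ^ 2 - S.trace) 2
      (multivariateGaussian 0 S) := memLp_two_norm_sq.sub (memLp_const _)
  have hv := variance_norm_sq hS
  rw [variance_eq_integral (by fun_prop), integral_norm_sq hS] at hv
  refine (measureReal_le_of_integral_le hm.integrable_sq (fun _ => sq_nonneg _) hv.le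
    (c := (K * frobNorm S) ^ 2) (by positivity) fun x hx => ?_).trans (le_of_eq ?_)
  · rw [← sq_abs (‖x‖ ^ 2 - S.trace)]
    exact pow_le_pow_left₀ (by positivity) hx 2
  · field_simp

theorem measureReal_abs_inner_ge (hS : S.PosSemidef) (hO : 0 < opNorm S)
    {η : EuclideanSpace ℝ (Fin p)} (hη : 0 < ‖η‖) {K : ℝ} (hK : 0 < K) :
    (multivariateGaussian 0 S).real {x | K * (Real.sqrt (opNorm S) * ‖η‖) ≤ |⟪η, x⟫|} ≤
      1 / K ^ 2 := by
  refine (measureReal_le_of_integral_le ((memLp_two_inner_sq η).integrable (by simp))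
    (fun _ => sq_nonneg _) ((integral_inner_sq hS η).le.trans (quadForm_le S η))
    (c := (K * (Real.sqrt (opNorm S) * ‖η‖)) ^ 2) (by positivity) fun x hx => ?_).trans
    (le_of_eq ?_)
  · rw [← sq_abs ⟪η, x⟫]
    exact pow_le_pow_left₀ (by positivity) hx 2
  · rw [mul_pow, mul_pow, Real.sq_sqrt hO.le]
    field_simp

/-- Expand `‖η + Y‖² = ‖η‖² + 2⟪η, Y⟫ + ‖Y‖²` at one grid time carrying the signal. No union bound
is needed there, so Chebyshev controls both random terms. -/
theorem alt_acceptance_le (hS : S.PosDef) (hp : 1 ≤ p) (hn : 6 ≤ n) (h3 : 3 ∣ n) {c C K ρ : ℝ}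
    (hc : c ≤ 1 / 144) (hpn : (p : ℝ) ≤ c * n) (hK : 0 < K) (hC : 4 * K ^ 2 + K + 1 < 2 * C)
    (hρ : 64 * C * rate n S ≤ ρ ^ 2) {s : ℕ} {θ : Columns p n} (hθ : θ ∈ altSpace p n s ρ) :
    (noiseLaw n S).real {Z | θ + Z ∉ rejectionRegion p n C} ≤ 900 * c + 3 / K ^ 2 := by
  obtain ⟨t, ht, hsignal⟩ := exists_cusum_signal (by lia) hθ
  obtain ⟨t₀, -, -, μ₁, μ₂, h₁, h₂, -, -⟩ := hθ
  obtain ⟨j, k, hjk, ⟨μ, hj⟩, ⟨ν, hk⟩⟩ := exists_two_const_blocks h₁ h₂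
  obtain ⟨ht1, ht2⟩ := candidateTimes_bounds (by lia) ht
  have hO := opNorm_pos hS hp
  have hF : 0 < frobNorm S := hO.trans_le (opNorm_le_frobNorm S)
  have hOR := opNorm_le_rate (S := S) hn
  have hFR := frobNorm_le_rate (S := S) hn
  have hR : 0 < rate n S := hO.trans_le hOR
  have hL := one_le_loglog8 hn
  have hC0 : 0 < C := by nlinarith [sq_nonneg K]
  set η := cusum t θ
  have hη2 : 16 * C * rate n S ≤ ‖η‖ ^ 2 := by linarith
  have hη : 0 < ‖η‖ := by
    have : 0 < ‖η‖ ^ 2 := (by positivity : 0 < 16 * C * rate n S).trans_le hη2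
    exact (norm_nonneg η).lt_of_ne fun h => by simp [← h] at this
  set A₁ : Set (Columns p n) := cusum t ⁻¹' {x | K * frobNorm S ≤ |‖x‖ ^ 2 - S.trace|} with hA₁
  set A₂ : Set (Columns p n) :=
    cusum t ⁻¹' {x | K * (Real.sqrt (opNorm S) * ‖η‖) ≤ |⟪η, x⟫|} with hA₂
  have hsub : {Z | θ + Z ∉ rejectionRegion p n C} ⊆ badNoise n S ∪ (A₁ ∪ A₂) := by
    intro Z hZ
    by_contra hcon
    rw [Set.mem_union, Set.mem_union, not_or, not_or] at hcon
    obtain ⟨hb, hY₁, hY₂⟩ := hcon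
    obtain ⟨b1, -, b3, -, b5⟩ := median_bounds hjk (isGoodEstimate_add h3 hn hb hj)
      (isGoodEstimate_add h3 hn hb hk)
    rw [Set.mem_ofPred_eq, rejectionRegion, Set.mem_ofPred_eq, not_lt] at hZ
    simp only [hA₁, hA₂, Set.mem_preimage, Set.mem_ofPred_eq, not_le] at hY₁ hY₂
    set Y := cusum t Z
    have hmax : ‖η + Y‖ ^ 2 ≤ maxCusumSq (θ + Z) := by
      have := Finset.le_sup' (fun t => ‖cusum t (θ + Z)‖ ^ 2) ht
      rwa [cusum_add] at this
    rw [norm_add_sq_real] at hmax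
    have hthr : max (medFrob (θ + Z) * Real.sqrt (loglog8 n)) (medOp (θ + Z) * loglog8 n) ≤
        10 * rate n S := by
      have hs := Real.sqrt_nonneg (loglog8 n)
      refine max_le ?_ ?_
      · have : frobNorm S * Real.sqrt (loglog8 n) ≤ rate n S := le_max_left _ _
        nlinarith
      · have : opNorm S * loglog8 n ≤ rate n S := le_max_right _ _
        nlinarith
    have hthr' := mul_le_mul_of_nonneg_left hthr hC0.le
    -- A quarter of the signal pays for the cross term, leaving `(3/4) ‖η‖² ≥ 12 C R` with `R = rate
    -- n S`.
    have hcross : 2 * (K * (Real.sqrt (opNorm S) * ‖η‖)) ≤ ‖η‖ ^ 2 / 4 + 4 * K ^ 2 * opNorm S := by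
      have h1 := sq_nonneg (‖η‖ / 2 - 2 * K * Real.sqrt (opNorm S))
      have h2 := Real.sq_sqrt hO.le
      have h3 : (‖η‖ / 2 - 2 * K * Real.sqrt (opNorm S)) ^ 2 = ‖η‖ ^ 2 / 4 +
          4 * K ^ 2 * Real.sqrt (opNorm S) ^ 2 - 2 * (K * (Real.sqrt (opNorm S) * ‖η‖)) := by ring
      rw [h2] at h3
      linarith
    have hKO : 4 * K ^ 2 * opNorm S ≤ 4 * K ^ 2 * rate n S :=
      mul_le_mul_of_nonneg_left hOR (by positivity)
    have hKF : K * frobNorm S ≤ K * rate n S := mul_le_mul_of_nonneg_left hFR hK.le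
    -- The remaining `12 C R` exceeds the threshold `10 C R` by `2 C R`, which covers `4K² R` from
    -- the cross term, `K R` from `‖Y‖²` and `R` from the trace error.
    have hfinal := mul_lt_mul_of_pos_right hC hR
    have y1 := (abs_lt.1 hY₁).1
    have y2 := (abs_lt.1 hY₂).1
    have b1' := (abs_le.1 b1).2
    linarith
  have hmp := measurePreserving_cusum (n := n) hS.posSemidef ht1 ht2
  have hP₁ : (noiseLaw n S).real A₁ ≤ 2 / K ^ 2 := by
    rw [hA₁, hmp.measureReal_preimage
      (measurableSet_le measurable_const (by fun_prop)).nullMeasurableSet]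
    exact measureReal_abs_norm_sq_sub_trace_ge hS.posSemidef hF hK
  have hP₂ : (noiseLaw n S).real A₂ ≤ 1 / K ^ 2 := by
    rw [hA₂, hmp.measureReal_preimage
      (measurableSet_le measurable_const (by fun_prop)).nullMeasurableSet]
    exact measureReal_abs_inner_ge hS.posSemidef hO hη hK
  have hbad := measureReal_badNoise_le hS hp h3 hc hpn
  have h4 := (measureReal_mono hsub (μ := noiseLaw n S)).trans (measureReal_union_le _ _)
  have h5 := measureReal_union_le (μ := noiseLaw n S) A₁ A₂
  have h6 : 2 / K ^ 2 + 1 / K ^ 2 = 3 / K ^ 2 := by ring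
  linarith

end Changepoint

/-! ### Choice of the constants and conclusion. -/

open Changepoint
theorem mainTheorem7 (A ε : ℝ) (hA : 0 < A) (hε : 0 < ε) :
    ∃ c C : ℝ, 0 < c ∧ 0 < C ∧
      ∀ (p n : ℕ) (_ : 1 ≤ p) (_ : 6 ≤ n) (_ : 3 ∣ n) (_ : (p : ℝ) ≤ c * n)
        (S : Matrix (Fin p) (Fin p) ℝ) (_ : S.PosDef)
        (_ : Real.sqrt p * opNorm S ≤ A * frobNorm S)
        (ρ : ℝ) (_ : 0 < ρ)
        (_ : 64 * C * max (frobNorm S * Real.sqrt (loglog8 n)) (opNorm S * loglog8 n) ≤ ρ ^ 2),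
        Measurable (psiCov C : Columns p n → ℝ) ∧
        (⨆ θ : nullSpace p n, ∫ X, psiCov C X ∂(dataLaw S θ.1)) +
          (⨆ θ : altSpace p n p ρ, ∫ X, (1 - psiCov C X) ∂(dataLaw S θ.1)) ≤ ε := by
  -- Four contributions of `ε/4`: the bad noise in each of the two errors, the union bound under the
  -- null, and Chebyshev under the alternative. Having `K ≥ 1` allows `3 / K² ≤ 3 / K`.
  set K : ℝ := 12 / ε + 1
  have hK : 1 ≤ K := by
    have : 0 < 12 / ε := by positivity
    linarith
  -- The part `11 + 64/ε` serves the null error, the bracket the alternative.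
  set C : ℝ := 11 + 64 / ε + (4 * K ^ 2 + K + 1)
  set c : ℝ := min (1 / 144) (ε / 3600)
  have hc : 0 < c := by positivity
  have hcε : 900 * c ≤ ε / 4 := by
    have : c ≤ ε / 3600 := min_le_right _ _
    linarith
  have hCε : 16 / (C - 11) ≤ ε / 4 := by
    have h1 : 64 / ε ≤ C - 11 := by
      have : 0 < 4 * K ^ 2 + K + 1 := by positivity
      simp only [C]
      linarith
    have h2 : 0 < 64 / ε := by positivity
    rw [div_le_iff₀ (by linarith)]
    calc (16 : ℝ) = ε / 4 * (64 / ε) := by field_simp; norm_num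
      _ ≤ _ := by gcongr
  have hC11 : 11 < C := by
    have : 0 < 64 / ε + (4 * K ^ 2 + K + 1) := by positivity
    simp only [C]
    linarith
  have hCK : 4 * K ^ 2 + K + 1 < 2 * C := by
    have : 0 < 64 / ε := by positivity
    have : 0 < 4 * K ^ 2 + K + 1 := by positivity
    simp only [C]
    linarith
  have hKε : 3 / K ^ 2 ≤ ε / 4 := by
    rw [div_le_iff₀ (by positivity)]
    calc (3 : ℝ) = ε / 4 * (12 / ε) := by field_simp; norm_num
      _ ≤ ε / 4 * K := by
          refine mul_le_mul_of_nonneg_left ?_ (by positivity)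
          simp only [K]
          linarith
      _ ≤ ε / 4 * K ^ 2 := by
          refine mul_le_mul_of_nonneg_left ?_ (by positivity)
          nlinarith
  refine ⟨c, C, hc, by linarith, fun p n hp hn h3 hpn S hS _ ρ _ hρ =>
    ⟨measurable_psiCov C, ?_⟩⟩
  have h1 : (⨆ θ : nullSpace p n, ∫ X, psiCov C X ∂(dataLaw S θ.1)) ≤ ε / 2 := by
    -- Nonnegativity of the bound replaces any check that the real supremum is over a nonempty
    -- family.
    refine Real.iSup_le (fun θ => ?_) (by positivity)
    rw [integral_psiCov]
    have := null_rejection_le hS hp hn h3 (min_le_left _ _) hpn hC11 θ.2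
    linarith
  have h2 : (⨆ θ : altSpace p n p ρ, ∫ X, (1 - psiCov C X) ∂(dataLaw S θ.1)) ≤ ε / 2 := by
    refine Real.iSup_le (fun θ => ?_) (by positivity)
    rw [integral_one_sub_psiCov]
    have := alt_acceptance_le hS hp hn h3 (min_le_left _ _) hpn (zero_lt_one.trans_le hK) hCK
      hρ θ.2
    linarith
  linarith
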